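/- **Setting.** Fix $n\ge 1$; a concept class $\mathcal C$ over $\{0,1\}^n$ is a set of functions $f:\{0,1\}^n\to\{0,1\}$. A learner and an adversary interact in rounds $t=1,2,\dots$. In round $t$ the adversary, given the learner's previous answer $y^{(t-1)}$, outputs the true label $f(x^{(t-1)})$ of the previous point and a new point $x^{(t)}\in\{0,1\}^n$; the learner is given $f(x^{(t-1)})$ and $x^{(t)}$ and answers $y^{(t)}\in\{0,1\}$. (In round $1$ there is no previous answer, which the adversary reads as $0$, and no previous label.) An adversary is an *adversary for $\mathcal C$* if, against every learner and at every time, the labelled examples revealed so far are consistent with some $f\in\mathcal C$. Let $\mathrm{mistakes}(A,\mathrm{Adv})\in\{0,1,\dots,\infty\}$ be the number of rounds $t\ge1$ with $y^{(t)}\ne f(x^{(t)})$. A *size-$s$ adversary* is a Boolean circuit with at most $s$ gates (AND, OR of fan-in two, NOT) that maintains a state of at most $s$ bits, initially $0$; the same circuit is run in every round, its inputs being the current state and $y^{(t-1)}$, and its outputs the next state, $f(x^{(t-1)})$ and $x^{(t)}$. A general (deterministic) learner is an arbitrary state machine. A *size-$m$ learner* maintains a state of $m$ bits, initially $0$, and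 performs each round in time $\mathrm{poly}(m,n)$ on a Turing machine. Below, the size-bounded learners are all given by one fixed Turing machine $M$, which works for all $n$ and all memory sizes $m$. **Theorem.** There are a polynomial $p$, a constant $c$ and a Turing machine $M$ that, on a state of $m$ bits, the previous label (if any) and a point of $\{0,1\}^n$, outputs a next state of $m$ bits and an answer in time $\mathrm{poly}(m,n)$, such that for all integers $n\ge1$ and $s\ge\max(n,2)$ there is a concept class $\mathcal C_s$ over $\{0,1\}^n$ with the following two properties. 1. There is an adversary $\mathrm{Adv}$ for $\mathcal C_s$ of size at most $s\log_2 s\cdot p(n)$ such that $\mathrm{mistakes}(A,\mathrm{Adv})\ge 2^n/4$ for every learner $A$. 2. For every size-$s$ adversary $\mathrm{Adv}_s$ for $\mathcal C_s$ there is $m\le c\,n\,s\log_2 s$ such that the size-$m$ learner $A_s$ given by $M$ satisfies $\mathrm{mistakes}(A_s,\mathrm{Adv}_s)\le c\,s\log_2 s$. -/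

import Mathlib

open scoped ENNReal

namespace OnlineLearning

/-! ### Boolean circuits -/

/-- A gate whose operands are taken among `k` available wires. -/
inductive Gate (k : ℕ) : Type
  | and (i j : Fin k) : Gate k
  | or (i j : Fin k) : Gate k
  | not (i : Fin k) : Gate k

/-- The value of a gate, given the values of the wires it may read. -/
def Gate.eval {k : ℕ} (w : Fin k → Bool) : Gate k → Bool
  | .and i j => w i && w j
  | .or i j => w i || w j
  | .not i => !w i

/-- Boolean circuits with `m` input bits and exactly `g` gates, listed in topological order. Each
gate reads input bits and values of earlier gates (arbitrary fan-out). There are `m + g` wires: the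
`m` inputs, followed by the outputs of the `g` gates. -/
inductive Circuit (m : ℕ) : ℕ → Type
  | nil : Circuit m 0
  | snoc {g : ℕ} (c : Circuit m g) (G : Gate (m + g)) : Circuit m (g + 1)

/-- The values of all wires of a circuit on the input `x`. -/
def Circuit.eval {m : ℕ} (x : Fin m → Bool) : {g : ℕ} → Circuit m g → (Fin (m + g) → Bool)
  | _, .nil => x
  | _, .snoc c G => Fin.snoc (α := fun _ => Bool) (c.eval x) (G.eval (c.eval x))

/-! ### Adversaries and learners -/

/-- A point of the domain `{0,1}ⁿ`. -/
abbrev Point (n : ℕ) : Type := Fin n → Bool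

/-- A concept class over `{0,1}ⁿ`. -/
abbrev ConceptClass (n : ℕ) : Type := Set (Point n → Bool)

/-- A (circuit) adversary over `{0,1}ⁿ`: one circuit that is run in every round. Its inputs are the
current state and, as last input bit, the learner's previous answer. The wires carrying the next
state, the true label of the previous point, and the next point are designated outputs. -/
structure Adversary (n : ℕ) : Type where
  /-- the number of bits of the state -/
  stateBits : ℕ
  /-- the number of gates of the circuit -/
  gates : ℕ
  circuit : Circuit (stateBits + 1) gates
  nextState : Fin stateBits → Fin (stateBits + 1 + gates)
  label : Fin (stateBits + 1 + gates)
  point : Fin n → Fin (stateBits + 1 + gates)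

/-- The size of an adversary. It is at most `s` iff the circuit has at most `s` gates and maintains
a state of at most `s` bits. (As an output may be any wire, an input bit included, state bits that
are merely moved around use no gate, so the length of the state has to be bounded as well.) -/
def Adversary.size {n : ℕ} (A : Adversary n) : ℕ := max A.gates A.stateBits

/-- The values of all wires in a round that starts in state `α` with previous learner answer `y`. -/
def Adversary.wires {n : ℕ} (A : Adversary n) (α : Fin A.stateBits → Bool) (y : Bool) :
    Fin (A.stateBits + 1 + A.gates) → Bool :=
  A.circuit.eval (Fin.snoc (α := fun _ => Bool) α y)

/-- A deterministic online learner over `{0,1}ⁿ`, with no bound on its memory or computing power.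
In each round it reads its state, the true label of the previous point (`none` in the first round,
where there is no such label) and the new point; it returns its next state and its answer. -/
structure Learner (n : ℕ) : Type 1 where
  State : Type
  init : State
  step : State → Option Bool → Point n → State × Bool

/-- The situation between two rounds: the states of both parties and the learner's last answer. -/
structure Config {n : ℕ} (L : Learner n) (A : Adversary n) : Type where
  adversaryState : Fin A.stateBits → Bool
  learnerState : L.State
  answer : Bool

variable {n : ℕ}

/-- The interaction of a learner and an adversary: the configuration before round `t`, where rounds
are numbered from `0`. The adversary starts with the all-zero state and reads `0` as learner answer
in round `0`; the label that it outputs in round `0` is ignored. -/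
def config (L : Learner n) (A : Adversary n) : ℕ → Config L A
  | 0 => ⟨fun _ => false, L.init, false⟩
  | t + 1 =>
    let c := config L A t
    let w := A.wires c.adversaryState c.answer
    let r := L.step c.learnerState (if t = 0 then none else some (w A.label))
      (fun i => w (A.point i))
    ⟨fun i => w (A.nextState i), r.1, r.2⟩

/-- The wires of the adversary's circuit in round `t`. -/
def wiresAt (L : Learner n) (A : Adversary n) (t : ℕ) : Fin (A.stateBits + 1 + A.gates) → Bool :=
  A.wires (config L A t).adversaryState (config L A t).answer

/-- The point presented in round `t`. -/
def pointAt (L : Learner n) (A : Adversary n) (t : ℕ) : Point n :=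
  fun i => wiresAt L A t (A.point i)

/-- The learner's answer in round `t`. -/
def answerAt (L : Learner n) (A : Adversary n) (t : ℕ) : Bool := (config L A (t + 1)).answer

/-- The true label of the point presented in round `t`; it is output by the adversary in the next
round, after it has seen the learner's answer. -/
def labelAt (L : Learner n) (A : Adversary n) (t : ℕ) : Bool := wiresAt L A (t + 1) A.label

/-- `A` is an adversary for the class `C`: whatever the learner does, the labelled examples revealed
up to any time are consistent with some concept of `C`. -/
def Adversary.IsFor (A : Adversary n) (C : ConceptClass n) : Prop :=
  ∀ (L : Learner n) (t : ℕ), ∃ f ∈ C, ∀ u < t, f (pointAt L A u) = labelAt L A u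

/-- The number of rounds, out of infinitely many, in which the learner errs. -/
noncomputable def mistakes (L : Learner n) (A : Adversary n) : ℕ∞ :=
  {t : ℕ | answerAt L A t ≠ labelAt L A t}.encard

/-! ### Efficient learners -/

/-- The input of a learning algorithm (state, previous label if any, new point) as a word over
`{0, 1, #}`, with `none` as the separator `#`. -/
def encodeInput (a : List Bool × Option Bool × List Bool) : List (Option Bool) :=
  a.1.map some ++ none :: (a.2.1.toList.map some ++ none :: a.2.2.map some)

/-- The output of a learning algorithm (next state, answer) as a word over `{0, 1}`. -/
def encodeOutput (b : List Bool × Bool) : List Bool := b.2 :: b.1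

/-- A uniform learning algorithm: a single Turing machine, for all dimensions and all memory sizes,
that performs one round in time polynomial in the length of its input, that is, in the number of
state bits plus the dimension. The length of the state never changes. -/
structure LearningAlgorithm : Type where
  step : List Bool × Option Bool × List Bool → List Bool × Bool
  length_step : ∀ a, (step a).1.length = a.1.length
  polyTime : Nonempty (Turing.TM2ComputableInPolyTime encodeInput encodeOutput step)

/-- The learner over `{0,1}ⁿ` given by a learning algorithm with an `m`-bit state, initially zero. -/
def LearningAlgorithm.toLearner (M : LearningAlgorithm) (n m : ℕ) : Learner n where
  State := List.Vector Bool m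
  init := List.Vector.replicate m false
  step α b x :=
    let r := M.step (α.toList, b, List.ofFn x)
    (⟨r.1, (M.length_step _).trans α.toList_length⟩, r.2)

end OnlineLearning

/-! The class consists of all concepts below a suitable function `h` (`dominated`). An adversary
that can evaluate `h` runs once through the cube and contradicts the learner wherever `h` is `1`.
Every such point except possibly the last costs a mistake, and all labels stay below `h`. So `h`
needs many ones and small circuits.

The learner `memo` stores the points that were labelled `1` and answers `1` exactly on those.
Against consistent labels it errs at most once per positive point (`mistakes_memo_le`), so small
adversaries must be kept from producing `k` positive points, where `k` is of order `s log s`. The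
memory size, and with it the learner, is fixed before `h`. Each adversary of size `s` then produces
one definite set of positive points in its game with this learner, and there are only `2 ^ O(s log
s)` such adversaries (`card_adversaryCode_le`). If `h` vanishes somewhere on every such set with at
least `k` elements, any adversary producing one of them violates the class.

A polynomial of degree less than `k` over the field with `2 ^ n` elements, projected to one bit,
supplies `h`. At `k` distinct points a random one has uniform, independent bits, so it is constant
on a given set of size at least `k` with probability at most `2 / 2 ^ k` (`card_constant_on_le`),
and a union bound applies. Adding a constant bit preserves non-constancy and lets `h` be `1` on at
least half of the cube. Horner's rule evaluates `h` with `O(k n³)` gates (`costLE_polynomial`).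

The remaining work shows that `memo` runs on a fixed machine in quadratic time (`Memo.run_program`).
-/

namespace OnlineLearning

/-! ### Bounded-time reachability -/

/-- `f` leads from `a` to `b` in at most `t` steps. -/
def ReachesIn {σ : Type*} (f : σ → Option σ) (t : ℕ) (a b : σ) : Prop :=
  ∃ j ≤ t, (flip bind f)^[j] (some a) = some b

theorem ReachesIn.refl {σ : Type*} (f : σ → Option σ) (a : σ) : ReachesIn f 0 a a :=
  ⟨0, le_rfl, rfl⟩

theorem ReachesIn.trans {σ : Type*} {f : σ → Option σ} {t u : ℕ} {a b c : σ}
    (h₁ : ReachesIn f t a b) (h₂ : ReachesIn f u b c) : ReachesIn f (t + u) a c := by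
  obtain ⟨i, hi, hi'⟩ := h₁
  obtain ⟨j, hj, hj'⟩ := h₂
  exact ⟨j + i, by omega, by rw [Function.iterate_add_apply, hi', hj']⟩

theorem ReachesIn.mono {σ : Type*} {f : σ → Option σ} {t u : ℕ} {a b : σ}
    (h : ReachesIn f t a b) (htu : t ≤ u) : ReachesIn f u a b := by
  obtain ⟨i, hi, hi'⟩ := h
  exact ⟨i, hi.trans htu, hi'⟩

theorem ReachesIn.single {σ : Type*} {f : σ → Option σ} {a b : σ} (h : f a = some b) :
    ReachesIn f 1 a b :=
  ⟨1, le_rfl, by simpa [flip] using h⟩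

theorem ReachesIn.head {σ : Type*} {f : σ → Option σ} {t : ℕ} {a b c : σ}
    (h : f a = some b) (h₂ : ReachesIn f t b c) : ReachesIn f (t + 1) a c :=
  ((ReachesIn.single h).trans h₂).mono (by omega)

/-! ### The learning algorithm

The reversed state is a sequence of blocks of `n + 1` bits, each made of a validity bit and a point.
The first block holds the previous point, and is valid iff the algorithm answered `0` there. It is
kept iff it is valid and the label turns out to be `1`. The algorithm answers `1` exactly on the
points that occur in a valid block. -/

/-- Whether some valid block of the word equals `x`. -/
def storesPoint (x : List Bool) : List Bool → Bool
  | [] => false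
  | v :: r => (v && x.isPrefixOf r) || storesPoint x (r.drop x.length)
termination_by l => l.length
decreasing_by simp

/-- The blocks that survive once the previous label is known. -/
def keptBlocks (ρ : List Bool) (b : Option Bool) (x : List Bool) : List Bool :=
  if b.getD false && (ρ.head? == some true) then ρ else ρ.tail.drop x.length

/-- The answer of the algorithm. -/
def memoAnswer (ρ : List Bool) (b : Option Bool) (x : List Bool) : Bool :=
  storesPoint x (keptBlocks ρ b x)

/-- The next reversed state of the algorithm. -/
def memoState (ρ : List Bool) (b : Option Bool) (x : List Bool) : List Bool :=
  ((!memoAnswer ρ b x) :: (x ++ keptBlocks ρ b x)).takeD ρ.length false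

/-- One round of the algorithm. -/
def memoStep (a : List Bool × Option Bool × List Bool) : List Bool × Bool :=
  ((memoState a.1.reverse a.2.1 a.2.2).reverse, memoAnswer a.1.reverse a.2.1 a.2.2)

theorem length_memoStep (a : List Bool × Option Bool × List Bool) :
    (memoStep a).1.length = a.1.length := by
  simp [memoStep, memoState, List.takeD_length]

/-! ### A Turing machine for the learning algorithm -/

namespace Memo

/-- The stacks: input, two copies of the blocks, a unary counter for the length of the state, an
auxiliary stack for the point, and output. -/
inductive Stack : Type
  | inp | work | copy | count | aux | out
  deriving DecidableEq

instance : Fintype Stack :=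
  ⟨{.inp, .work, .copy, .count, .aux, .out}, fun k => by cases k <;> decide⟩

/-- The stack alphabets. -/
abbrev Alphabet : Stack → Type
  | .inp => Option Bool
  | _ => Bool

/-- The program labels. -/
inductive Label : Type
  | read | label | drop | rewind | block | compare | flush | prepend | emit | clean
  deriving DecidableEq

instance : Fintype Label :=
  ⟨{.read, .label, .drop, .rewind, .block, .compare, .flush, .prepend, .emit, .clean},
    fun l => by cases l <;> decide⟩

/-- The internal variables: the last symbols popped from the input and from the other stacks, the
previous label, whether the current block matches so far, and whether some block has matched. -/
structure Vars : Type where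
  sym : Option (Option Bool)
  bit : Option Bool
  lab : Bool
  hit : Bool
  found : Bool
  deriving DecidableEq, Fintype

/-- The initial values of the variables. -/
def Vars.start : Vars := ⟨none, none, false, false, false⟩

/-- Forget the symbols popped last. -/
def Vars.clear (v : Vars) : Vars := { v with sym := none, bit := none }

/-- The bit in the symbol popped last from the input. -/
def Vars.inputBit (v : Vars) : Option Bool := v.sym.join

open Turing.TM2.Stmt

/-- The program. -/
def program : Label → Turing.TM2.Stmt Alphabet Label Vars
  | .read =>
    pop .inp (fun v o => { v with sym := o }) <|
    branch (fun v => v.inputBit.isSome)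
      (push .work (fun v => v.inputBit.getD false) <|
       push .copy (fun v => v.inputBit.getD false) <|
       push .count (fun _ => true) <|
       goto fun _ => .read)
      (load Vars.clear <| goto fun _ => .label)
  | .label =>
    pop .inp (fun v o => { v with sym := o }) <|
    branch (fun v => v.inputBit.isSome)
      (load (fun v => { v with lab := v.inputBit.getD false }) <|
       pop .inp (fun v _ => v) <|
       peek .work (fun v o => { v with bit := o }) <|
       branch (fun v => v.lab && (v.bit == some true))
        (load Vars.clear <| goto fun _ => .block)
        (pop .work (fun v _ => v) <| pop .copy (fun v _ => v) <|
          load Vars.clear <| goto fun _ => .drop))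
      (pop .work (fun v _ => v) <| pop .copy (fun v _ => v) <|
        load Vars.clear <| goto fun _ => .drop)
  | .drop =>
    pop .inp (fun v o => { v with sym := o }) <|
    branch (fun v => v.inputBit.isSome)
      (push .aux (fun v => v.inputBit.getD false) <|
       pop .work (fun v _ => v) <| pop .copy (fun v _ => v) <|
       goto fun _ => .drop)
      (load Vars.clear <| goto fun _ => .rewind)
  | .rewind =>
    pop .aux (fun v o => { v with bit := o }) <|
    branch (fun v => v.bit.isSome)
      (push .inp (fun v => v.bit) <| goto fun _ => .rewind)
      (load Vars.clear <| goto fun _ => .block)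
  | .block =>
    pop .work (fun v o => { v with bit := o }) <|
    branch (fun v => v.bit.isSome)
      (load (fun v => { v with hit := v.bit.getD false }) <| load Vars.clear <|
        goto fun _ => .compare)
      (load Vars.clear <| goto fun _ => .flush)
  | .compare =>
    pop .inp (fun v o => { v with sym := o }) <|
    branch (fun v => v.inputBit.isSome)
      (push .aux (fun v => v.inputBit.getD false) <|
       pop .work (fun v o => { v with bit := o }) <|
       load (fun v => { v with hit := v.hit && (v.bit == v.inputBit) }) <|
       goto fun _ => .compare)
      (load (fun v => { v with found := v.hit || v.found, hit := false }) <|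
       load Vars.clear <| goto fun _ => .rewind)
  | .flush =>
    pop .inp (fun v o => { v with sym := o }) <|
    branch (fun v => v.inputBit.isSome)
      (push .aux (fun v => v.inputBit.getD false) <| goto fun _ => .flush)
      (load Vars.clear <| goto fun _ => .prepend)
  | .prepend =>
    pop .aux (fun v o => { v with bit := o }) <|
    branch (fun v => v.bit.isSome)
      (push .copy (fun v => v.bit.getD false) <| goto fun _ => .prepend)
      (load Vars.clear <| push .copy (fun v => !v.found) <| goto fun _ => .emit)
  | .emit =>
    pop .count (fun v o => { v with bit := o }) <|
    branch (fun v => v.bit.isSome)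
      (pop .copy (fun v o => { v with bit := o }) <|
       push .out (fun v => v.bit.getD false) <| goto fun _ => .emit)
      (load Vars.clear <| goto fun _ => .clean)
  | .clean =>
    pop .copy (fun v o => { v with bit := o }) <|
    branch (fun v => v.bit.isSome)
      (goto fun _ => .clean)
      (push .out (fun v => v.found) <| load (fun _ => Vars.start) <| halt)

/-- The stacks with given contents. -/
def contents (i : List (Option Bool)) (w c n a o : List Bool) : ∀ k, List (Alphabet k)
  | .inp => i
  | .work => w
  | .copy => c
  | .count => n
  | .aux => a
  | .out => o

section
variable (i i' : List (Option Bool)) (w c n a o l : List Bool)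

@[simp] theorem update_inp :
    Function.update (contents i w c n a o) .inp i' = contents i' w c n a o := by
  funext k; cases k <;> rfl

@[simp] theorem update_work :
    Function.update (contents i w c n a o) .work l = contents i l c n a o := by
  funext k; cases k <;> rfl

@[simp] theorem update_copy :
    Function.update (contents i w c n a o) .copy l = contents i w l n a o := by
  funext k; cases k <;> rfl

@[simp] theorem update_count :
    Function.update (contents i w c n a o) .count l = contents i w c l a o := by
  funext k; cases k <;> rfl

@[simp] theorem update_aux :
    Function.update (contents i w c n a o) .aux l = contents i w c n l o := by
  funext k; cases k <;> rfl

@[simp] theorem update_out :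
    Function.update (contents i w c n a o) .out l = contents i w c n a l := by
  funext k; cases k <;> rfl

@[simp] theorem contents_inp : contents i w c n a o .inp = i := rfl
@[simp] theorem contents_work : contents i w c n a o .work = w := rfl
@[simp] theorem contents_copy : contents i w c n a o .copy = c := rfl
@[simp] theorem contents_count : contents i w c n a o .count = n := rfl
@[simp] theorem contents_aux : contents i w c n a o .aux = a := rfl
@[simp] theorem contents_out : contents i w c n a o .out = o := rfl

end

/-- Reachability for the program. -/
abbrev Run (t : ℕ) (c c' : Turing.TM2.Cfg Alphabet Label Vars) : Prop :=
  ReachesIn (Turing.TM2.step program) t c c'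

variable (i : List (Option Bool)) (w c n a o x : List Bool) (s : Option (Option Bool))
  (b : Option Bool) (lab hit found : Bool)

/-- Pushing the state onto stacks reverses it; this is why the block structure is imposed on the
reversed state. -/
theorem run_read (α : List Bool) :
    Run (α.length + 1)
      ⟨some .read, ⟨s, b, lab, hit, found⟩, contents (α.map some ++ none :: i) w c n a o⟩
      ⟨some .label, ⟨none, none, lab, hit, found⟩,
        contents i (α.reverse ++ w) (α.reverse ++ c) (List.replicate α.length true ++ n) a o⟩ := by
  induction α generalizing w c n s b with
  | nil => exact .single (by simp [program, Vars.inputBit, Vars.clear])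
  | cons y α ih =>
    refine .head (b := ⟨some .read, ⟨some (some y), b, lab, hit, found⟩,
      contents (α.map some ++ none :: i) (y :: w) (y :: c) (true :: n) a o⟩)
      (by simp [program, Vars.inputBit]) ?_
    convert ih (y :: w) (y :: c) (true :: n) (some (some y)) b using 3
    all_goals simp [List.replicate_succ']

theorem run_drop :
    Run (x.length + 1)
      ⟨some .drop, ⟨s, b, lab, hit, found⟩, contents (x.map some) w c n a o⟩
      ⟨some .rewind, ⟨none, none, lab, hit, found⟩,
        contents [] (w.drop x.length) (c.drop x.length) n (x.reverse ++ a) o⟩ := by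
  induction x generalizing w c a s b with
  | nil => exact .single (by simp [program, Vars.inputBit, Vars.clear])
  | cons y x ih =>
    refine .head (b := ⟨some .drop, ⟨some (some y), b, lab, hit, found⟩,
      contents (x.map some) w.tail c.tail n (y :: a) o⟩)
      (by simp [program, Vars.inputBit]) ?_
    convert ih w.tail c.tail (y :: a) (some (some y)) b using 3
    all_goals simp

theorem run_rewind :
    Run (a.length + 1)
      ⟨some .rewind, ⟨s, b, lab, hit, found⟩, contents i w c n a o⟩
      ⟨some .block, ⟨none, none, lab, hit, found⟩,
        contents (a.reverse.map some ++ i) w c n [] o⟩ := by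
  induction a generalizing i s b with
  | nil => exact .single (by simp [program, Vars.clear])
  | cons y a ih =>
    refine .head (b := ⟨some .rewind, ⟨s, some y, lab, hit, found⟩,
      contents (some y :: i) w c n a o⟩)
      (by simp [program]) ?_
    convert ih (some y :: i) s (some y) using 3
    all_goals simp

theorem run_compare :
    Run (x.length + 1)
      ⟨some .compare, ⟨s, b, lab, hit, found⟩, contents (x.map some) w c n a o⟩
      ⟨some .rewind, ⟨none, none, lab, false, hit && x.isPrefixOf w || found⟩,
        contents [] (w.drop x.length) c n (x.reverse ++ a) o⟩ := by
  induction x generalizing w a s b hit with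
  | nil => exact .single (by simp [program, Vars.inputBit, Vars.clear])
  | cons y x ih =>
    refine .head (b := ⟨some .compare,
      ⟨some (some y), w.head?, lab, hit && (w.head? == some y), found⟩,
      contents (x.map some) w.tail c n (y :: a) o⟩)
      (by simp [program, Vars.inputBit]) ?_
    have e : (hit && (y :: x).isPrefixOf w) =
        (hit && (w.head? == some y) && x.isPrefixOf w.tail) := by
      cases w with
      | nil => simp
      | cons z w =>
        have : (z == y) = (y == z) := by cases z <;> cases y <;> rfl
        simp [Bool.and_assoc, this, List.isPrefixOf_cons_cons]
    rw [e]
    convert ih w.tail (y :: a) (some (some y)) w.head? (hit && (w.head? == some y)) using 3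
    all_goals simp

/-- One block costs one step, plus `x.length + 1` to compare and as many to move the point back from
`.aux` to `.inp`. Each block consumes at least its validity bit, so any bound `N` on the length of
the scanned word also bounds the number of blocks. -/
theorem run_blocks :
    ∀ (N : ℕ) (w : List Bool) (found : Bool), w.length ≤ N →
    Run ((N + 1) * (2 * x.length + 3))
      ⟨some .block, ⟨none, none, lab, hit, found⟩, contents (x.map some) w c n [] o⟩
      ⟨some .flush, ⟨none, none, lab, if w = [] then hit else false, storesPoint x w || found⟩,
        contents (x.map some) [] c n [] o⟩ := by
  intro N
  induction N generalizing hit with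
  | zero =>
    intro w found hw
    obtain rfl : w = [] := List.length_eq_zero_iff.1 (by omega)
    refine ReachesIn.mono (.single ?_) (show 1 ≤ _ by nlinarith)
    simp [program, Vars.clear, storesPoint]
  | succ N ih =>
    intro w found hw
    cases w with
    | nil =>
      refine ReachesIn.mono (.single ?_) (show 1 ≤ _ by nlinarith)
      simp [program, Vars.clear, storesPoint]
    | cons v r =>
      have h1 : Run 1
          ⟨some .block, ⟨none, none, lab, hit, found⟩, contents (x.map some) (v :: r) c n [] o⟩
          ⟨some .compare, ⟨none, none, lab, v, found⟩, contents (x.map some) r c n [] o⟩ :=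
        .single (by simp [program, Vars.clear])
      have h2 := run_compare r c n [] o x none none lab v found
      have h3 := run_rewind [] (r.drop x.length) c n (x.reverse ++ []) o none none lab false
        (v && x.isPrefixOf r || found)
      have h4 := ih false (r.drop x.length) (v && x.isPrefixOf r || found) (by simp at hw ⊢; omega)
      simp only [List.append_nil, List.reverse_reverse, List.length_reverse, ite_self] at h2 h3 h4
      have h := ((h1.trans h2).trans h3).trans h4
      rw [storesPoint]
      have e : (v && x.isPrefixOf r || storesPoint x (r.drop x.length) || found) =
          (storesPoint x (r.drop x.length) || (v && x.isPrefixOf r || found)) := by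
        cases storesPoint x (r.drop x.length) <;> simp
      simp only [reduceCtorEq, if_false, e]
      exact h.mono (by ring_nf; omega)

theorem run_flush :
    Run (x.length + 1)
      ⟨some .flush, ⟨s, b, lab, hit, found⟩, contents (x.map some) w c n a o⟩
      ⟨some .prepend, ⟨none, none, lab, hit, found⟩, contents [] w c n (x.reverse ++ a) o⟩ := by
  induction x generalizing a s b with
  | nil => exact .single (by simp [program, Vars.inputBit, Vars.clear])
  | cons y x ih =>
    refine .head (b := ⟨some .flush, ⟨some (some y), b, lab, hit, found⟩,
      contents (x.map some) w c n (y :: a) o⟩)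
      (by simp [program, Vars.inputBit]) ?_
    convert ih (y :: a) (some (some y)) b using 3
    all_goals simp

theorem run_prepend :
    Run (a.length + 1)
      ⟨some .prepend, ⟨s, b, lab, hit, found⟩, contents i w c n a o⟩
      ⟨some .emit, ⟨none, none, lab, hit, found⟩,
        contents i w ((!found) :: (a.reverse ++ c)) n [] o⟩ := by
  induction a generalizing c s b with
  | nil => exact .single (by simp [program, Vars.clear])
  | cons y a ih =>
    refine .head (b := ⟨some .prepend, ⟨s, some y, lab, hit, found⟩,
      contents i w (y :: c) n a o⟩)
      (by simp [program]) ?_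
    convert ih (y :: c) s (some y) using 3
    all_goals simp

/-- The unary counter restores the length of the state. An exhausted stack pops `none`, which is
read as `false`, and this is exactly the padding of `takeD`. -/
theorem run_emit :
    Run (n.length + 1)
      ⟨some .emit, ⟨s, b, lab, hit, found⟩, contents i w c n a o⟩
      ⟨some .clean, ⟨none, none, lab, hit, found⟩,
        contents i w (c.drop n.length) [] a ((c.takeD n.length false).reverse ++ o)⟩ := by
  induction n generalizing c o s b with
  | nil => exact .single (by simp [program, Vars.clear])
  | cons y n ih =>
    refine .head (b := ⟨some .emit, ⟨s, c.head?, lab, hit, found⟩,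
      contents i w c.tail n a (c.head?.getD false :: o)⟩)
      (by simp [program]) ?_
    convert ih c.tail (c.head?.getD false :: o) s c.head? using 3
    all_goals simp

/-- A proper halting configuration has empty stacks apart from the output and reset variables, so
bits beyond the length of the state must be discarded. -/
theorem run_clean :
    Run (c.length + 1)
      ⟨some .clean, ⟨s, b, lab, hit, found⟩, contents i w c n a o⟩
      ⟨none, Vars.start, contents i w [] n a (found :: o)⟩ := by
  induction c generalizing s b with
  | nil => exact .single (by simp [program])
  | cons y c ih =>
    refine .head (b := ⟨some .clean, ⟨s, some y, lab, hit, found⟩,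
      contents i w c n a o⟩)
      (by simp [program]) ?_
    exact ih s (some y)

theorem run_label (ρ : List Bool) (b : Option Bool) :
    Run (2 * x.length + 3)
      ⟨some .label, Vars.start,
        contents (b.toList.map some ++ none :: x.map some) ρ ρ n [] o⟩
      ⟨some .block, ⟨none, none, b.getD false, false, false⟩,
        contents (x.map some) (keptBlocks ρ b x) (keptBlocks ρ b x) n [] o⟩ := by
  have key (lab : Bool) : Run (2 * x.length + 2)
      ⟨some .drop, ⟨none, none, lab, false, false⟩, contents (x.map some) ρ.tail ρ.tail n [] o⟩
      ⟨some .block, ⟨none, none, lab, false, false⟩,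
        contents (x.map some) (ρ.tail.drop x.length) (ρ.tail.drop x.length) n [] o⟩ := by
    have h1 := run_drop ρ.tail ρ.tail n [] o x none none lab false false
    have h2 := run_rewind [] (ρ.tail.drop x.length) (ρ.tail.drop x.length) n (x.reverse ++ []) o
      none none lab false false
    simp only [List.append_nil, List.reverse_reverse, List.length_reverse] at h1 h2
    exact (h1.trans h2).mono (by omega)
  cases b with
  | none =>
    refine .head ?_ (by simpa [keptBlocks] using key false)
    simp [program, Vars.start, Vars.clear, Vars.inputBit]
  | some b =>
    by_cases h : b && (ρ.head? == some true)
    · simp only [keptBlocks, Option.getD_some, h, if_true]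
      refine ReachesIn.mono (.single ?_) (show 1 ≤ _ by omega)
      simp only [Bool.and_eq_true, beq_iff_eq] at h
      simp [program, Vars.start, Vars.clear, Vars.inputBit, h.1, h.2]
    · simp only [keptBlocks, Option.getD_some, h]
      refine .head ?_ (key b)
      rw [Bool.not_eq_true] at h
      simp [program, Vars.start, Vars.clear, Vars.inputBit, h]

theorem length_keptBlocks_le (ρ : List Bool) (b : Option Bool) :
    (keptBlocks ρ b x).length ≤ ρ.length := by
  unfold keptBlocks
  split_ifs
  · rfl
  · simp

/-- The scan over the blocks dominates with about `m * x.length` steps; all other phases are linear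
in the input length. -/
theorem run_program (A : List Bool × Option Bool × List Bool) :
    Run (20 * ((encodeInput A).length + 1) ^ 2)
      ⟨some .read, Vars.start, contents (encodeInput A) [] [] [] [] []⟩
      ⟨none, Vars.start, contents [] [] [] [] [] (encodeOutput (memoStep A))⟩ := by
  obtain ⟨α, b, x⟩ := A
  set ρ := α.reverse with hρ
  set κ := keptBlocks ρ b x with hκ
  set m := α.length with hm
  have h1 := run_read (b.toList.map some ++ none :: x.map some) [] [] [] [] [] none none
    false false false α
  have h2 := run_label (List.replicate m true ++ []) [] x ρ b
  have hl : κ.length ≤ m := by simpa [hκ, hρ] using length_keptBlocks_le x ρ b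
  have h3 := run_blocks κ (List.replicate m true ++ []) [] x (b.getD false) false m κ false hl
  have h4 := run_flush [] κ (List.replicate m true ++ []) [] [] x none none
    (b.getD false) false (storesPoint x κ)
  have h5 := run_prepend [] [] κ (List.replicate m true ++ []) (x.reverse ++ []) [] none none
    (b.getD false) false (storesPoint x κ)
  have h6 := run_emit [] [] ((!storesPoint x κ) :: (x ++ κ)) (List.replicate m true ++ []) [] []
    none none (b.getD false) false (storesPoint x κ)
  have h7 := run_clean [] [] (((!storesPoint x κ) :: (x ++ κ)).drop m) [] []
    ((((!storesPoint x κ) :: (x ++ κ)).takeD m false).reverse) none none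
    (b.getD false) false (storesPoint x κ)
  simp only [List.append_nil, ← hρ, ← hκ, ite_self, Bool.or_false, List.reverse_reverse,
    List.length_replicate, List.length_reverse, ← hm] at h1 h2 h3 h4 h5 h6 h7
  have h := (((((h1.trans h2).trans h3).trans h4).trans h5).trans h6).trans h7
  have ei : encodeInput (α, b, x) =
      α.map some ++ none :: (b.toList.map some ++ none :: x.map some) := rfl
  have eo : encodeOutput (memoStep (α, b, x)) = storesPoint x κ ::
      (((!storesPoint x κ) :: (x ++ κ)).takeD m false).reverse := by
    simp only [encodeOutput, memoStep, memoState, memoAnswer, ← hκ, ← hρ, hm]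
    simp [hρ]
  rw [eo]
  refine ReachesIn.mono (by rw [ei]; exact h) ?_
  · have e : (encodeInput (α, b, x)).length = m + (b.toList.length + (x.length + 2)) := by
      simp [encodeInput, hm]; ring
    have e2 : (((!storesPoint x κ) :: (x ++ κ)).drop m).length ≤ x.length + m + 1 := by
      simp; omega
    rw [e]
    nlinarith [Nat.zero_le b.toList.length, Nat.zero_le m, Nat.zero_le x.length,
      Nat.zero_le (m * x.length)]

/-- The machine. -/
def machine : Turing.FinTM2 where
  K := Stack
  k₀ := .inp
  k₁ := .out
  Γ := Alphabet
  Λ := Label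
  main := .read
  σ := Vars
  initialState := Vars.start
  Γk₀Fin := inferInstanceAs (Fintype (Option Bool))
  m := program

theorem initList_machine (l : List (Option Bool)) :
    Turing.initList machine l = ⟨some .read, Vars.start, contents l [] [] [] [] []⟩ := by
  unfold Turing.initList
  congr 1
  funext k
  cases k <;> rfl

theorem haltList_machine (l : List Bool) :
    Turing.haltList machine l = ⟨none, Vars.start, contents [] [] [] [] [] l⟩ := by
  unfold Turing.haltList
  congr 1
  funext k
  cases k <;> rfl

end Memo

/-- The algorithm that answers `1` exactly on the points whose label is known to be `1`. -/
def memo : LearningAlgorithm where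
  step := memoStep
  length_step := length_memoStep
  polyTime := by
    refine ⟨⟨⟨Memo.machine, Equiv.refl _, Equiv.refl _⟩, 20 * (Polynomial.X + 1) ^ 2,
      fun A => Classical.choice ?_⟩⟩
    obtain ⟨j, hj, h⟩ := Memo.run_program A
    refine ⟨⟨⟨j, ?_⟩, by simpa using hj⟩⟩
    have e (l : List (Option Bool)) :
        List.map (Equiv.refl (Option Bool)).invFun l = l := List.map_id l
    have e' (l : List Bool) : List.map (Equiv.refl Bool).invFun l = l := List.map_id l
    erw [e, e', Memo.initList_machine, Option.map_some, Memo.haltList_machine]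
    exact h

/-! ### The behaviour of the learning algorithm -/

section Memo
variable {n : ℕ}

/-- A block of the state. -/
def block (v : Bool) (p : Point n) : List Bool := v :: List.ofFn p

/-- The blocks of a list of stored points. -/
def storedBlocks (D : List (Point n)) : List Bool := D.flatMap (block true)

@[simp] theorem length_block (v : Bool) (p : Point n) : (block v p).length = n + 1 := by
  simp [block]

@[simp] theorem length_storedBlocks (D : List (Point n)) :
    (storedBlocks D).length = D.length * (n + 1) := by
  simp [storedBlocks, List.length_flatMap]

/-- Zero padding parses as invalid blocks, even when its length is not a multiple of the block
length. -/
theorem storesPoint_replicate (x : List Bool) (j : ℕ) :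
    storesPoint x (List.replicate j false) = false := by
  induction j using Nat.strong_induction_on with
  | _ j ih =>
    cases j with
    | zero => simp [storesPoint]
    | succ j =>
      rw [List.replicate_succ, storesPoint, List.drop_replicate, ih _ (by omega)]
      rfl

theorem storesPoint_block (x p : Point n) (v : Bool) (r : List Bool) :
    storesPoint (List.ofFn x) (block v p ++ r) =
      ((v && decide (x = p)) || storesPoint (List.ofFn x) r) := by
  have h : (List.ofFn x).isPrefixOf (List.ofFn p ++ r) = decide (x = p) := by
    rw [Bool.eq_iff_iff, List.isPrefixOf_iff_prefix, decide_eq_true_iff]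
    constructor
    · intro h
      have := List.prefix_of_prefix_length_le h (List.prefix_append _ _) (by simp)
      exact List.ofFn_injective (this.eq_of_length (by simp))
    · rintro rfl
      exact List.prefix_append _ _
  rw [block, List.cons_append, storesPoint, h, List.drop_left' (by simp)]

theorem storesPoint_storedBlocks (x : Point n) (D : List (Point n)) (j : ℕ) :
    storesPoint (List.ofFn x) (storedBlocks D ++ List.replicate j false) = decide (x ∈ D) := by
  induction D with
  | nil => simp [storedBlocks, storesPoint_replicate]
  | cons p D ih =>
    have : storedBlocks (p :: D) = block true p ++ storedBlocks D := by simp [storedBlocks]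
    rw [this, List.append_assoc, storesPoint_block, ih, Bool.eq_iff_iff]
    simp

theorem takeD_append_replicate {α : Type*} (l : List α) (d : α) (m j : ℕ) (h : l.length ≤ m) :
    (l ++ List.replicate j d).takeD m d = l ++ List.replicate (m - l.length) d := by
  induction l generalizing m with
  | nil =>
    induction j generalizing m with
    | zero => simp
    | succ j ih =>
      cases m with
      | zero => simp
      | succ m => simpa [List.replicate_succ] using ih m (Nat.zero_le _)
  | cons a l ih =>
    cases m with
    | zero => simp at h
    | succ m => simpa using ih m (by simpa using h)

theorem keptBlocks_block (v : Bool) (p x : Point n) (b : Option Bool) (D : List (Point n)) (j : ℕ) :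
    keptBlocks (block v p ++ (storedBlocks D ++ List.replicate j false)) b (List.ofFn x) =
      storedBlocks (if b.getD false && v then p :: D else D) ++ List.replicate j false := by
  unfold keptBlocks
  have hv : ((block v p ++ (storedBlocks D ++ List.replicate j false)).head? == some true) = v := by
    cases v <;> rfl
  rw [hv]
  split_ifs with h
  · obtain rfl : v = true := by simp at h; exact h.2
    simp [storedBlocks]
  · rw [block, List.cons_append, List.tail_cons, List.drop_left' (by simp)]

/-- One round of the algorithm on a state that stores the points of `D` and has `p` pending. -/
theorem memoStep_block {v : Bool} {p x : Point n} {b : Option Bool} {D D' : List (Point n)} {j : ℕ}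
    {α : List Bool} (hα : α.reverse = block v p ++ (storedBlocks D ++ List.replicate j false))
    (hD' : D' = if b.getD false && v then p :: D else D)
    (hlen : (D'.length + 1) * (n + 1) ≤ α.length) :
    (memoStep (α, b, List.ofFn x)).2 = decide (x ∈ D') ∧
    ∃ i, (memoStep (α, b, List.ofFn x)).1.reverse =
      block (!decide (x ∈ D')) x ++ (storedBlocks D' ++ List.replicate i false) := by
  have hk := keptBlocks_block v p x b D j
  rw [← hD', ← hα] at hk
  have ha : memoAnswer α.reverse b (List.ofFn x) = decide (x ∈ D') := by
    rw [memoAnswer, hk, storesPoint_storedBlocks]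
  refine ⟨ha, α.length - (block (!decide (x ∈ D')) x ++ storedBlocks D').length, ?_⟩
  have e : (!decide (x ∈ D')) :: (List.ofFn x ++ (storedBlocks D' ++ List.replicate j false)) =
      (block (!decide (x ∈ D')) x ++ storedBlocks D') ++ List.replicate j false := by
    simp [block]
  simp only [memoStep, memoState, List.reverse_reverse, ha, hk, List.length_reverse]
  rw [e, takeD_append_replicate, List.append_assoc]
  simp
  linarith

end Memo

variable {n : ℕ}

/-- The points that are labelled `1` in some round. -/
def positives (L : Learner n) (A : Adversary n) : Set (Point n) :=
  {x | ∃ t, pointAt L A t = x ∧ labelAt L A t = true}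

/-- The loop invariant. The pending block is valid only if its point is not yet stored, so the list
stays free of repetitions and never outgrows the set of positive points. The `+ 1` in `hm` is room
for the pending block, so truncation never loses a stored point. -/
theorem memo_state {m : ℕ} (A : Adversary n)
    (hm : ((positives (memo.toLearner n m) A).ncard + 1) * (n + 1) ≤ m) (t : ℕ) :
    ∃ D : List (Point n), D.Nodup ∧
      (∀ x, x ∈ D ↔ ∃ u < t, pointAt (memo.toLearner n m) A u = x ∧
        labelAt (memo.toLearner n m) A u = true) ∧
      answerAt (memo.toLearner n m) A t = decide (pointAt (memo.toLearner n m) A t ∈ D) ∧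
      ∃ i, (List.Vector.toList (config (memo.toLearner n m) A (t + 1)).learnerState).reverse =
        block (!decide (pointAt (memo.toLearner n m) A t ∈ D)) (pointAt (memo.toLearner n m) A t) ++
          (storedBlocks D ++ List.replicate i false) := by
  set L := memo.toLearner n m with hL
  have hcard (D : List (Point n)) (hD : D.Nodup) (hs : ∀ x ∈ D, x ∈ positives L A) :
      (D.length + 1) * (n + 1) ≤ m := by
    refine le_trans (Nat.mul_le_mul_right _ (Nat.succ_le_succ ?_)) hm
    rw [← List.toFinset_card_of_nodup hD, ← Set.ncard_coe_finset]
    exact Set.ncard_le_ncard (fun x hx => hs x (by simpa using hx)) (Set.toFinite _)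
  induction t with
  | zero =>
    refine ⟨[], List.nodup_nil, by simp, ?_⟩
    have hm' : n + 1 ≤ m := by nlinarith
    -- The all-zero initial state reads as an invalid pending block followed by an empty store.
    have hα : (List.replicate m false).reverse = block false (fun _ : Fin n => false) ++
        (storedBlocks ([] : List (Point n)) ++ List.replicate (m - (n + 1)) false) := by
      simp only [block, storedBlocks, List.reverse_replicate, List.ofFn_const, List.flatMap_nil,
        List.nil_append, ← List.replicate_succ, List.replicate_append_replicate]
      congr 1; omega
    exact memoStep_block (b := none) (x := pointAt L A 0) hα (D' := []) (by simp)
      (le_trans (by simpa using hm') (List.Vector.toList_length (n := m) _).ge)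
  | succ t ih =>
    obtain ⟨D, hD, hmem, -, i, hi⟩ := ih
    replace hmem : ∀ x, x ∈ D ↔ ∃ u < t, pointAt L A u = x ∧ labelAt L A u = true := hmem
    set D' := if labelAt L A t && !decide (pointAt L A t ∈ D) then pointAt L A t :: D else D with hD'
    have hmem' : ∀ x, x ∈ D' ↔ ∃ u < t + 1, pointAt L A u = x ∧ labelAt L A u = true := by
      intro x
      simp only [Nat.lt_succ_iff_lt_or_eq, or_and_right, exists_or, exists_eq_left, ← hmem]
      rw [hD']
      split_ifs with h
      · simp only [Bool.and_eq_true] at h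
        simp only [List.mem_cons, h.1, and_true]
        rw [eq_comm (a := x)]
        tauto
      · simp only [Bool.and_eq_true, Bool.not_eq_true', decide_eq_false_iff_not, not_and,
          not_not] at h
        constructor
        · exact Or.inl
        · rintro (hx | ⟨rfl, hx⟩)
          exacts [hx, h hx]
    have hnd : D'.Nodup := by
      rw [hD']
      split_ifs with h
      · simp only [Bool.and_eq_true, Bool.not_eq_true', decide_eq_false_iff_not] at h
        exact List.nodup_cons.2 ⟨h.2, hD⟩
      · exact hD
    have hlen := hcard D' hnd fun x hx => by
      obtain ⟨u, -, hu⟩ := (hmem' x).1 hx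
      exact ⟨u, hu⟩
    refine ⟨D', hnd, hmem', ?_⟩
    exact memoStep_block (b := some (labelAt L A t)) (x := pointAt L A (t + 1)) hi
      (D' := D') hD' (hlen.trans_eq (List.Vector.toList_length (n := m) _).symm)

/-- With enough memory, the algorithm answers `1` exactly on the points that were labelled `1`. -/
theorem memo_answerAt {m : ℕ} (A : Adversary n)
    (hm : ((positives (memo.toLearner n m) A).ncard + 1) * (n + 1) ≤ m) (t : ℕ) :
    answerAt (memo.toLearner n m) A t = true ↔
      ∃ u < t, pointAt (memo.toLearner n m) A u = pointAt (memo.toLearner n m) A t ∧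
        labelAt (memo.toLearner n m) A u = true := by
  obtain ⟨D, -, hmem, hans, -⟩ := memo_state A hm t
  rw [hans, decide_eq_true_iff, hmem]

/-- With enough memory, the algorithm errs at most once per point that is labelled `1`. -/
theorem mistakes_memo_le {m : ℕ} {A : Adversary n} {C : ConceptClass n} (hA : A.IsFor C)
    (hm : ((positives (memo.toLearner n m) A).ncard + 1) * (n + 1) ≤ m) :
    mistakes (memo.toLearner n m) A ≤ (positives (memo.toLearner n m) A).ncard := by
  have hans := memo_answerAt A hm
  set L := memo.toLearner n m
  -- A wrong answer `1` would mean that the same point received both labels, which no concept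
  -- allows. Hence an error occurs only when a point is labelled `1` for the first time, and errors
  -- inject into the positive points.
  have key : ∀ t, answerAt L A t ≠ labelAt L A t →
      labelAt L A t = true ∧ ∀ u < t, pointAt L A u = pointAt L A t → labelAt L A u = false := by
    intro t ht
    have hl : labelAt L A t = true := by
      by_contra hl
      have ha : answerAt L A t = true := by
        cases h : answerAt L A t <;> simp_all
      obtain ⟨u, hu, hp, hlu⟩ := (hans t).1 ha
      obtain ⟨f, -, hf⟩ := hA L (t + 1)
      have h1 := hf u (by omega)
      have h2 := hf t (by omega)
      rw [hp, h2] at h1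
      exact hl (h1.trans hlu)
    refine ⟨hl, fun u hu hp => ?_⟩
    by_contra hlu
    exact ht (((hans t).2 ⟨u, hu, hp, by simpa using hlu⟩).trans hl.symm)
  rw [Set.Finite.cast_ncard_eq (Set.toFinite _)]
  refine Set.encard_le_encard_of_injOn (f := pointAt L A) (fun t ht => ⟨t, rfl, (key t ht).1⟩) ?_
  intro t ht u hu h
  by_contra hne
  rcases lt_or_gt_of_ne hne with hlt | hlt
  · have := (key u hu).2 t hlt h
    rw [(key t ht).1] at this
    exact absurd this (by decide)
  · have := (key t ht).2 u hlt h.symm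
    rw [(key u hu).1] at this
    exact absurd this (by decide)

/-! ### Circuits for functions with values in the field with two elements -/

/-- The bit that represents an element of `ZMod 2`. -/
def toBit (z : ZMod 2) : Bool := decide (z = 1)

/-- The element of `ZMod 2` represented by a bit. -/
def ofBit (b : Bool) : ZMod 2 := if b then 1 else 0

@[simp] theorem toBit_ofBit (b : Bool) : toBit (ofBit b) = b := by cases b <;> rfl

@[simp] theorem ofBit_toBit (z : ZMod 2) : ofBit (toBit z) = z := by revert z; decide

theorem toBit_mul (y z : ZMod 2) : toBit (y * z) = (toBit y && toBit z) := by revert y z; decide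

theorem toBit_add_add_mul (y z : ZMod 2) : toBit (y + z + y * z) = (toBit y || toBit z) := by
  revert y z; decide

theorem toBit_one_add (z : ZMod 2) : toBit (1 + z) = !toBit z := by revert z; decide

section Cost
variable {m : ℕ}

/-- Some wire of the circuit carries the function `f`. -/
def Circuit.Computes {g : ℕ} (c : Circuit m g) (f : (Fin m → Bool) → ZMod 2) : Prop :=
  ∃ w, ∀ x, c.eval x w = toBit (f x)

theorem Circuit.Computes.snoc {g : ℕ} {c : Circuit m g} {f : (Fin m → Bool) → ZMod 2}
    (h : c.Computes f) (G : Gate (m + g)) : (c.snoc G).Computes f := by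
  obtain ⟨w, hw⟩ := h
  refine ⟨w.castSucc, fun x => ?_⟩
  rw [← hw, Circuit.eval]
  exact Fin.snoc_castSucc (α := fun _ => Bool) _ _ _

theorem Circuit.computes_snoc_self {g : ℕ} (c : Circuit m g) {f : (Fin m → Bool) → ZMod 2}
    (G : Gate (m + g)) (h : ∀ x, G.eval (c.eval x) = toBit (f x)) : (c.snoc G).Computes f := by
  refine ⟨Fin.last (m + g), fun x => ?_⟩
  rw [← h, Circuit.eval]
  exact Fin.snoc_last (α := fun _ => Bool) _ _

/-- Some circuit with at most `g` gates computes all functions in `S`. -/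
def Realizable (g : ℕ) (S : Set ((Fin m → Bool) → ZMod 2)) : Prop :=
  ∃ g' ≤ g, ∃ c : Circuit m g', ∀ f ∈ S, c.Computes f

/-- At most `q` additional gates are needed to compute `T` once `S` has been computed. -/
def CostLE (S T : Set ((Fin m → Bool) → ZMod 2)) (q : ℕ) : Prop :=
  ∀ S' ⊇ S, ∀ g, Realizable g S' → Realizable (g + q) (S' ∪ T)

variable {S S' T T' U : Set ((Fin m → Bool) → ZMod 2)} {f h : (Fin m → Bool) → ZMod 2} {q r : ℕ}

theorem Realizable.mono {g g' : ℕ} (h : Realizable g S) (hg : g ≤ g') (hS : S' ⊆ S) :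
    Realizable g' S' := by
  obtain ⟨i, hi, c, hc⟩ := h
  exact ⟨i, hi.trans hg, c, fun f hf => hc f (hS hf)⟩

theorem realizable_inputs :
    Realizable 0 (Set.range fun (i : Fin m) (x : Fin m → Bool) => ofBit (x i)) := by
  refine ⟨0, le_rfl, .nil, ?_⟩
  rintro _ ⟨i, rfl⟩
  exact ⟨i, fun x => by simp [Circuit.eval]⟩

theorem CostLE.mono (h : CostLE S T q) (hS : S ⊆ S') (hT : T' ⊆ T) (hq : q ≤ r) :
    CostLE S' T' r := fun W hW g hg =>
  (h W (hS.trans hW) g hg).mono (by omega) (Set.union_subset_union_right _ hT)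

theorem CostLE.of_subset (h : T ⊆ S) : CostLE S T 0 := fun _ hW _ hg =>
  hg.mono le_rfl (Set.union_subset le_rfl (h.trans hW))

/-- Costs add up because `CostLE` quantifies over all supersets of `S`: whatever has been computed
stays available, as fan-out is unrestricted. -/
theorem CostLE.trans (h₁ : CostLE S T q) (h₂ : CostLE (S ∪ T) U r) : CostLE S (T ∪ U) (q + r) :=
  fun W hW g hg => (h₂ (W ∪ T) (Set.union_subset_union_left _ hW) (g + q) (h₁ W hW g hg)).mono
    (by omega) (by rw [Set.union_assoc])

theorem CostLE.trans' (h₁ : CostLE S T q) (h₂ : CostLE (S ∪ T) U r) : CostLE S U (q + r) :=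
  (h₁.trans h₂).mono le_rfl Set.subset_union_right le_rfl

theorem CostLE.union (h₁ : CostLE S T q) (h₂ : CostLE S U r) : CostLE S (T ∪ U) (q + r) :=
  h₁.trans (h₂.mono Set.subset_union_left le_rfl le_rfl)

theorem costLE_of_gate (H : ∀ g (c : Circuit m g), (∀ f ∈ S, c.Computes f) →
    ∃ G : Gate (m + g), ∀ x, G.eval (c.eval x) = toBit (f x)) : CostLE S {f} 1 := by
  rintro W hW g ⟨g', hg', c, hc⟩
  obtain ⟨G, hG⟩ := H g' c fun f hf => hc f (hW hf)
  refine ⟨g' + 1, by omega, c.snoc G, ?_⟩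
  rintro u (hu | rfl)
  · exact (hc u hu).snoc G
  · exact c.computes_snoc_self G hG

theorem costLE_mul (hf : f ∈ S) (hh : h ∈ S) : CostLE S {f * h} 1 :=
  costLE_of_gate fun g c hc => by
    obtain ⟨i, hi⟩ := hc f hf
    obtain ⟨j, hj⟩ := hc h hh
    exact ⟨.and i j, fun x => by simp [Gate.eval, hi, hj, toBit_mul]⟩

theorem costLE_or (hf : f ∈ S) (hh : h ∈ S) : CostLE S {f + h + f * h} 1 :=
  costLE_of_gate fun g c hc => by
    obtain ⟨i, hi⟩ := hc f hf
    obtain ⟨j, hj⟩ := hc h hh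
    exact ⟨.or i j, fun x => by simp [Gate.eval, hi, hj, toBit_add_add_mul]⟩

theorem costLE_one_add (hf : f ∈ S) : CostLE S {1 + f} 1 :=
  costLE_of_gate fun g c hc => by
    obtain ⟨i, hi⟩ := hc f hf
    exact ⟨.not i, fun x => by simp [Gate.eval, hi, toBit_one_add]⟩

theorem costLE_add (hf : f ∈ S) (hh : h ∈ S) : CostLE S {f + h} 4 := by
  -- XOR as (OR) AND NOT (AND), hence four gates.
  have e : (f + h + f * h) * (1 + f * h) = f + h := by
    funext x
    simp only [Pi.add_apply, Pi.mul_apply, Pi.one_apply]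
    generalize f x = y
    generalize h x = z
    revert y z
    decide
  have h1 : CostLE S ({f + h + f * h} ∪ {f * h}) 2 := (costLE_or hf hh).union (costLE_mul hf hh)
  have h2 := h1.trans (costLE_one_add (f := f * h) (by simp))
  have h3 := h2.trans' (costLE_mul (f := f + h + f * h) (h := 1 + f * h) (by simp) (by simp))
  rwa [e] at h3

/-- The constants can be computed from any function. -/
theorem costLE_const (hf : f ∈ S) : CostLE S {0, 1} 3 := by
  have e : f + (1 + f) + f * (1 + f) = 1 := by
    funext x
    simp only [Pi.add_apply, Pi.mul_apply, Pi.one_apply]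
    generalize f x = y
    revert y
    decide
  have e' : (1 + 1 : (Fin m → Bool) → ZMod 2) = 0 := by
    funext x
    rfl
  have h1 := (costLE_one_add hf).trans' (costLE_or (f := f) (h := 1 + f) (by simp [hf]) (by simp))
  rw [e] at h1
  have h2 := h1.trans (costLE_one_add (f := 1) (by simp))
  rw [e'] at h2
  exact h2.mono le_rfl (by rw [Set.union_comm]; exact le_rfl) le_rfl

theorem CostLE.sum {ι : Type*} (I : Finset ι) (u : ι → (Fin m → Bool) → ZMod 2) (h0 : 0 ∈ S)
    (H : ∀ i ∈ I, CostLE S {u i} q) : CostLE S {∑ i ∈ I, u i} (I.card * (q + 4)) := by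
  classical
  induction I using Finset.induction_on with
  | empty => exact (CostLE.of_subset (by simpa using h0)).mono le_rfl le_rfl (Nat.zero_le _)
  | insert i I hi ih =>
    have h1 := (H i (by simp)).union (ih fun j hj => H j (by simp [hj]))
    have h2 := h1.trans' (costLE_add (f := u i) (h := ∑ i ∈ I, u i) (by simp) (by simp))
    rw [Finset.sum_insert hi, Finset.card_insert_of_notMem hi]
    exact h2.mono le_rfl le_rfl (by ring_nf; omega)

theorem CostLE.prod {ι : Type*} (I : Finset ι) (u : ι → (Fin m → Bool) → ZMod 2) (h1 : 1 ∈ S)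
    (H : ∀ i ∈ I, u i ∈ S) : CostLE S {∏ i ∈ I, u i} I.card := by
  classical
  induction I using Finset.induction_on with
  | empty => exact (CostLE.of_subset (by simpa using h1)).mono le_rfl le_rfl (Nat.zero_le _)
  | insert i I hi ih =>
    have h2 := (ih fun j hj => H j (by simp [hj])).trans'
      (costLE_mul (f := u i) (h := ∏ i ∈ I, u i) (by simp [H i]) (by simp))
    rw [Finset.prod_insert hi, Finset.card_insert_of_notMem hi]
    exact h2

theorem CostLE.range {ι : Type*} [Fintype ι] (u : ι → (Fin m → Bool) → ZMod 2)
    (H : ∀ i, CostLE S {u i} q) : CostLE S (Set.range u) (Fintype.card ι * q) := by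
  classical
  have key : ∀ I : Finset ι, CostLE S (u '' I) (I.card * q) := by
    intro I
    induction I using Finset.induction_on with
    | empty => exact (CostLE.of_subset (by simp)).mono le_rfl le_rfl (Nat.zero_le _)
    | insert i I hi ih =>
      rw [Finset.card_insert_of_notMem hi, Finset.coe_insert, Set.image_insert_eq,
        Set.insert_eq]
      exact ((H i).union ih).mono le_rfl le_rfl (by ring_nf; omega)
  simpa using key Finset.univ

end Cost

/-! ### Arithmetic in an extension of the field with two elements -/

section Field
variable {m n : ℕ} {F : Type*} [Field F] [Algebra (ZMod 2) F] (b : Module.Basis (Fin n) (ZMod 2) F)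
  {S : Set ((Fin m → Bool) → ZMod 2)}

/-- The coordinates of a function with values in `F`. -/
def coords (U : (Fin m → Bool) → F) : Set ((Fin m → Bool) → ZMod 2) :=
  Set.range fun (l : Fin n) (x : Fin m → Bool) => b.repr (U x) l

theorem const_mem (h0 : 0 ∈ S) (h1 : 1 ∈ S) (d : ZMod 2) :
    (fun _ => d : (Fin m → Bool) → ZMod 2) ∈ S := by
  have : d = 0 ∨ d = 1 := by revert d; decide
  rcases this with rfl | rfl
  exacts [h0, h1]

theorem repr_mul_add (u v c : F) (l : Fin n) :
    b.repr (u * v + c) l =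
      (∑ i, ∑ j, b.repr u i * b.repr v j * b.repr (b i * b j) l) + b.repr c l := by
  conv_lhs => rw [← b.sum_repr u, ← b.sum_repr v]
  simp only [Finset.sum_mul_sum, map_add, map_sum, Finsupp.add_apply, Finsupp.finsetSum_apply,
    smul_mul_smul_comm, map_smul, Finsupp.smul_apply, smul_eq_mul]

/-- Each coordinate of a product is a bilinear form given by the structure constants of the basis. A
term takes two ANDs and every addition takes four gates, which gives `6` per term, `4` per inner sum
and `4` for the constant `c`. -/
theorem costLE_mul_add (h0 : 0 ∈ S) (h1 : 1 ∈ S) {U V : (Fin m → Bool) → F}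
    (hU : coords b U ⊆ S) (hV : coords b V ⊆ S) (c : F) :
    CostLE S (coords b fun x => U x * V x + c) (n * (n * (n * 6 + 4) + 4)) := by
  have key := CostLE.range (S := S)
    (fun (l : Fin n) (x : Fin m → Bool) => b.repr (U x * V x + c) l)
    (q := n * (n * 6 + 4) + 4) ?_
  · rw [Fintype.card_fin] at key
    exact key
  intro l
  have e : (fun x => b.repr (U x * V x + c) l) =
      (∑ i, ∑ j, (fun x => b.repr (U x) i) * (fun x => b.repr (V x) j) *
        (fun _ => b.repr (b i * b j) l)) + (fun _ => b.repr c l) := by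
    funext x
    rw [repr_mul_add]
    simp [Finset.sum_apply]
  rw [e]
  refine CostLE.trans' (T := {∑ i, ∑ j, (fun x => b.repr (U x) i) * (fun x => b.repr (V x) j) *
        (fun _ => b.repr (b i * b j) l)}) ?_ (costLE_add (by simp)
          (Set.mem_union_left _ (const_mem h0 h1 _)))
  have h2 := CostLE.sum (S := S) Finset.univ (fun i => ∑ j, (fun x => b.repr (U x) i) *
    (fun x => b.repr (V x) j) * (fun _ => b.repr (b i * b j) l)) h0 (q := n * 6) fun i _ => by
      have h3 := CostLE.sum (S := S) Finset.univ (fun j => (fun x => b.repr (U x) i) *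
        (fun x => b.repr (V x) j) * (fun _ => b.repr (b i * b j) l)) h0 (q := 2) fun j _ =>
          (costLE_mul (hU ⟨i, rfl⟩) (hV ⟨j, rfl⟩)).trans' (costLE_mul (by simp)
            (Set.mem_union_left _ (const_mem h0 h1 _)))
      simpa using h3
  simpa using h2

theorem costLE_polynomial (h0 : 0 ∈ S) (h1 : 1 ∈ S) {U : (Fin m → Bool) → F}
    (hU : coords b U ⊆ S) {k : ℕ} (a : Fin k → F) :
    CostLE S (coords b fun x => ∑ i, a i * U x ^ (i : ℕ)) (k * (n * (n * (n * 6 + 4) + 4))) := by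
  induction k with
  | zero =>
    refine (CostLE.of_subset ?_).mono le_rfl le_rfl (Nat.zero_le _)
    rintro _ ⟨l, rfl⟩
    simp only [Finset.univ_eq_empty, Finset.sum_empty, map_zero, Finsupp.coe_zero, Pi.zero_apply]
    exact h0
  | succ k ih =>
    -- Horner's rule: splitting off the constant coefficient leaves one multiplication and addition
    -- per coefficient.
    have e : (fun x => ∑ i, a i * U x ^ (i : ℕ)) =
        fun x => (∑ i : Fin k, a i.succ * U x ^ (i : ℕ)) * U x + a 0 := by
      funext x
      rw [Fin.sum_univ_succ, Finset.sum_mul, add_comm]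
      simp [pow_succ, mul_assoc]
    rw [e]
    refine ((ih fun i => a i.succ).trans' (costLE_mul_add b (Or.inl h0) (Or.inl h1)
      Set.subset_union_right (hU.trans Set.subset_union_left) (a 0))).mono le_rfl le_rfl ?_
    ring_nf; omega

end Field

/-! ### The number of small adversaries -/

/-- Gates are pairs or single operands. -/
def gateEquiv (k : ℕ) : Gate k ≃ (Fin k × Fin k) ⊕ (Fin k × Fin k) ⊕ Fin k where
  toFun
    | .and i j => .inl (i, j)
    | .or i j => .inr (.inl (i, j))
    | .not i => .inr (.inr i)
  invFun
    | .inl (i, j) => .and i j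
    | .inr (.inl (i, j)) => .or i j
    | .inr (.inr i) => .not i
  left_inv G := by cases G <;> rfl
  right_inv c := by rcases c with _ | _ | _ <;> rfl

/-- A nonempty circuit consists of a circuit and one more gate. -/
def circuitEquiv (m g : ℕ) : Circuit m (g + 1) ≃ Circuit m g × Gate (m + g) where
  toFun | .snoc c G => (c, G)
  invFun c := .snoc c.1 c.2
  left_inv c := by cases c; rfl
  right_inv _ := rfl

instance (k : ℕ) : Finite (Gate k) := .of_equiv _ (gateEquiv k).symm

instance (m g : ℕ) : Finite (Circuit m g) := by
  induction g with
  | zero => exact @Finite.of_subsingleton _ ⟨fun a b => by cases a; cases b; rfl⟩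
  | succ g ih => exact .of_equiv _ (circuitEquiv m g).symm

theorem card_gate_le (k : ℕ) : Nat.card (Gate k) ≤ 3 * k ^ 2 := by
  rw [Nat.card_congr (gateEquiv k)]
  simp only [Nat.card_sum, Nat.card_prod, Nat.card_fin]
  nlinarith [Nat.le_self_pow two_ne_zero k]

theorem card_circuit_le (m g W : ℕ) (h : m + g ≤ W) :
    Nat.card (Circuit m g) ≤ (3 * W ^ 2) ^ g := by
  induction g with
  | zero =>
    rw [pow_zero]
    have : Subsingleton (Circuit m 0) := ⟨fun a b => by cases a; cases b; rfl⟩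
    exact Finite.card_le_one_iff_subsingleton.2 this
  | succ g ih =>
    rw [Nat.card_congr (circuitEquiv m g), Nat.card_prod, pow_succ]
    refine Nat.mul_le_mul (ih (by omega)) ((card_gate_le _).trans ?_)
    gcongr
    omega

/-- The data of an adversary of size at most `s`. -/
abbrev AdversaryCode (n s : ℕ) : Type :=
  Σ (b : Fin (s + 1)) (g : Fin (s + 1)), Circuit (b.1 + 1) g.1 ×
    (Fin b.1 → Fin (b.1 + 1 + g.1)) × Fin (b.1 + 1 + g.1) × (Fin n → Fin (b.1 + 1 + g.1))

/-- The adversary with given data. -/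
def AdversaryCode.decode {n s : ℕ} (a : AdversaryCode n s) : Adversary n where
  stateBits := a.1
  gates := a.2.1
  circuit := a.2.2.1
  nextState := a.2.2.2.1
  label := a.2.2.2.2.1
  point := a.2.2.2.2.2

theorem AdversaryCode.exists_decode {n s : ℕ} (A : Adversary n) (hA : A.size ≤ s) :
    ∃ a : AdversaryCode n s, a.decode = A := by
  obtain ⟨b, g, c, u, l, p⟩ := A
  have hb : b < s + 1 := Nat.lt_succ_of_le ((le_max_right _ _).trans hA)
  have hg : g < s + 1 := Nat.lt_succ_of_le ((le_max_left _ _).trans hA)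
  exact ⟨⟨⟨b, hb⟩, ⟨g, hg⟩, c, u, l, p⟩, rfl⟩

/-- With at most `W = 2 * s + 1` wires, each of the at most `s` gates has at most `3 * W ^ 2`
choices and each of the at most `2 * s + 1` designated outputs has at most `W`. The exponent is `14
* s * L + 7 * L`, and `s ≥ 2` absorbs the second term. -/
theorem card_adversaryCode_le {n s L : ℕ} (hn : n ≤ s) (hs : 2 ≤ s) (hL : s ≤ 2 ^ L) :
    Nat.card (AdversaryCode n s) ≤ 2 ^ (18 * s * L) := by
  have hL1 : 1 ≤ L := by
    rcases Nat.eq_zero_or_pos L with rfl | h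
    · simp at hL; omega
    · exact h
  set W := 2 * s + 1 with hW
  have key : ∀ b g : Fin (s + 1), Nat.card (Circuit (b.1 + 1) g.1 ×
      (Fin b.1 → Fin (b.1 + 1 + g.1)) × Fin (b.1 + 1 + g.1) × (Fin n → Fin (b.1 + 1 + g.1))) ≤
      (3 * W ^ 2) ^ s * (W ^ s * (W * W ^ s)) := by
    intro b g
    have hw : b.1 + 1 + g.1 ≤ W := by omega
    simp only [Nat.card_prod, Nat.card_fun, Nat.card_fin]
    have hW1 : 1 ≤ W := by omega
    have h3 : 1 ≤ 3 * W ^ 2 := by nlinarith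
    gcongr
    · exact (card_circuit_le _ _ _ hw).trans (Nat.pow_le_pow_right h3 (by omega))
    · omega
  have h1 : Nat.card (AdversaryCode n s) ≤
      (s + 1) * ((s + 1) * ((3 * W ^ 2) ^ s * (W ^ s * (W * W ^ s)))) := by
    rw [Nat.card_sigma]
    refine (Finset.sum_le_card_nsmul _ _ ((s + 1) * ((3 * W ^ 2) ^ s * (W ^ s * (W * W ^ s))))
      fun b _ => ?_).trans_eq (by simp)
    rw [Nat.card_sigma]
    refine (Finset.sum_le_card_nsmul _ _ _ fun g _ => key b g).trans_eq ?_
    simp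
  have e1 : s + 1 ≤ 2 ^ (2 * L) := by
    have : 2 ^ (2 * L) = 2 ^ L * 2 ^ L := by rw [two_mul, pow_add]
    nlinarith
  have e2 : W ≤ 2 ^ (3 * L) := by
    have h : 2 ^ (3 * L) = 2 ^ L * 2 ^ (2 * L) := by rw [← pow_add]; congr 1; ring
    nlinarith
  have e3 : 3 * W ^ 2 ≤ 2 ^ (8 * L) := by
    have h : 2 ^ (8 * L) = 2 ^ (2 * L) * (2 ^ (3 * L)) ^ 2 := by
      rw [← pow_mul, ← pow_add]; congr 1; ring
    rw [h]
    exact Nat.mul_le_mul (by omega) (Nat.pow_le_pow_left e2 2)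
  calc Nat.card (AdversaryCode n s)
      ≤ 2 ^ (2 * L) * (2 ^ (2 * L) * ((2 ^ (8 * L)) ^ s *
          ((2 ^ (3 * L)) ^ s * (2 ^ (3 * L) * (2 ^ (3 * L)) ^ s)))) := by
        refine h1.trans ?_
        gcongr
    _ = 2 ^ (14 * s * L + 7 * L) := by
        simp only [← pow_mul, ← pow_add]
        congr 1
        ring
    _ ≤ 2 ^ (18 * s * L) := Nat.pow_le_pow_right two_pos (by nlinarith)

/-! ### Polynomials that are not constant on given sets -/

section Hash
variable {F : Type*} [Field F] [Fintype F] [Algebra (ZMod 2) F] (φ : F →ₗ[ZMod 2] ZMod 2)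

open Classical in
-- Evaluation at `k` distinct points is given by an invertible Vandermonde matrix. Followed by `φ`,
-- it is a surjective additive map onto `Fin k → ZMod 2`; its fibres all have the same size, and
-- only two of them consist of polynomials that are constant on the chosen points.
theorem card_constant_on_le (hφ : Function.Surjective φ) {k : ℕ} (T : Finset F) (hT : k ≤ T.card) :
    (Finset.univ.filter fun a : Fin k → F =>
      ∃ e, ∀ x ∈ T, φ (∑ i, a i * x ^ (i : ℕ)) = e).card * 2 ^ k ≤ 2 * Fintype.card F ^ k := by
  -- Being constant on `T` implies being constant on any `k` of its points.
  obtain ⟨T', hT', rfl⟩ := Finset.exists_subset_card_eq hT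
  set k := T'.card
  set x : Fin k → F := fun i => (T'.equivFin.symm i : F)
  have hx : Function.Injective x := Subtype.val_injective.comp T'.equivFin.symm.injective
  have hxT : ∀ i, x i ∈ T := fun i => hT' (T'.equivFin.symm i).2
  have hdet : IsUnit (Matrix.vandermonde x) :=
    (Matrix.isUnit_iff_isUnit_det _).2 (Matrix.det_vandermonde_ne_zero_iff.2 hx).isUnit
  let Ψ : (Fin k → F) →+ (Fin k → ZMod 2) :=
    { toFun := fun a j => φ (∑ i, a i * x j ^ (i : ℕ))
      map_zero' := by ext; simp
      map_add' := fun a a' => by ext; simp [add_mul, Finset.sum_add_distrib] }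
  have hΨ : Function.Surjective Ψ := by
    intro y
    choose z hz using fun j => hφ (y j)
    obtain ⟨a, ha⟩ := (Matrix.mulVec_surjective_iff_isUnit.2 hdet) z
    refine ⟨a, funext fun j => ?_⟩
    have := congrFun ha j
    simp only [Matrix.mulVec, dotProduct, Matrix.vandermonde_apply] at this
    rw [← hz j, ← this]
    simp only [Ψ, AddMonoidHom.coe_mk, ZeroHom.coe_mk, mul_comm]
  have hfib : ∀ y, (Finset.univ.filter fun a => Ψ a = y).card * 2 ^ k = Fintype.card F ^ k := by
    intro y
    have h := Finset.card_eq_sum_card_fiberwise (s := (Finset.univ : Finset (Fin k → F)))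
      (t := Finset.univ) (f := Ψ) fun _ _ => Finset.mem_coe.2 (Finset.mem_univ _)
    rw [Finset.sum_congr rfl fun y' _ => AddMonoidHom.card_fiber_eq_of_mem_range Ψ
      (hΨ y') (hΨ y)] at h
    simp only [Finset.sum_const, Finset.card_univ, Fintype.card_fun, Fintype.card_fin, ZMod.card,
      smul_eq_mul] at h
    rw [h, mul_comm]
  calc _ ≤ ((Finset.univ : Finset (ZMod 2)).biUnion fun e =>
        Finset.univ.filter fun a => Ψ a = fun _ => e).card * 2 ^ k := by
        refine Nat.mul_le_mul_right _ (Finset.card_le_card fun a ha => ?_)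
        obtain ⟨e, he⟩ := (Finset.mem_filter.1 ha).2
        simp only [Finset.mem_biUnion, Finset.mem_univ, Finset.mem_filter, true_and]
        exact ⟨e, funext fun j => he _ (hxT j)⟩
    _ ≤ (∑ e : ZMod 2, (Finset.univ.filter fun a => Ψ a = fun _ => e).card) * 2 ^ k :=
        Nat.mul_le_mul_right _ Finset.card_biUnion_le
    _ = 2 * Fintype.card F ^ k := by
        rw [Finset.sum_mul, Finset.sum_congr rfl fun e _ => hfib _]
        simp

/-- Given fewer than `2 ^ (k - 1)` sets with at least `k` elements, some polynomial of degree less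
than `k` is, after projection to the field with two elements, constant on none of them. -/
theorem exists_polynomial_not_constant (hφ : Function.Surjective φ) {k : ℕ} {J : Type*} [Finite J]
    (hJ : 2 * Nat.card J < 2 ^ k) (T : J → Finset F) :
    ∃ a : Fin k → F, ∀ j, k ≤ (T j).card →
      ∀ e, ∃ x ∈ T j, φ (∑ i, a i * x ^ (i : ℕ)) ≠ e := by
  classical
  have := Fintype.ofFinite J
  by_contra! H
  set B : J → Finset (Fin k → F) := fun j =>
    if k ≤ (T j).card then Finset.univ.filter fun a : Fin k → F =>
      ∃ e, ∀ x ∈ T j, φ (∑ i, a i * x ^ (i : ℕ)) = e else ∅ with hB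
  -- Union bound: if every coefficient vector failed, the bad sets would cover the whole space,
  -- although each has density at most `2 / 2 ^ k`.
  have hcov : (Finset.univ : Finset (Fin k → F)) ⊆ Finset.univ.biUnion B := by
    intro a _
    obtain ⟨j, hj, e, he⟩ := H a
    rw [Finset.mem_biUnion]
    refine ⟨j, Finset.mem_univ _, ?_⟩
    simp only [hB, hj, if_true, Finset.mem_filter, Finset.mem_univ, true_and]
    exact ⟨e, he⟩
  have hBj : ∀ j, (B j).card * 2 ^ k ≤ 2 * Fintype.card F ^ k := by
    intro j
    simp only [hB]
    split_ifs with h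
    · exact card_constant_on_le φ hφ (T j) h
    · simp
  have h1 : Fintype.card F ^ k * 2 ^ k ≤ Nat.card J * (2 * Fintype.card F ^ k) := by
    calc Fintype.card F ^ k * 2 ^ k ≤ (∑ j, (B j).card) * 2 ^ k := by
          refine Nat.mul_le_mul_right _ ?_
          have := (Finset.card_le_card hcov).trans Finset.card_biUnion_le
          simpa using this
      _ ≤ Nat.card J * (2 * Fintype.card F ^ k) := by
          rw [Finset.sum_mul]
          exact (Finset.sum_le_card_nsmul _ _ _ fun j _ => hBj j).trans_eq
            (by simp [Nat.card_eq_fintype_card])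
  have hpos : 0 < Fintype.card F ^ k := pow_pos Fintype.card_pos k
  nlinarith

end Hash

/-! ### Counting in binary -/

/-- The point given by the binary digits of a number. -/
def bits (n t : ℕ) : Point n := fun i => t.testBit i

theorem bits_injOn {n t u : ℕ} (ht : t < 2 ^ n) (hu : u < 2 ^ n) (h : bits n t = bits n u) :
    t = u := by
  refine Nat.eq_of_testBit_eq fun i => ?_
  by_cases hi : i < n
  · exact congrFun h ⟨i, hi⟩
  · have h2 : 2 ^ n ≤ 2 ^ i := Nat.pow_le_pow_right two_pos (by omega)
    rw [Nat.testBit_lt_two_pow (by omega), Nat.testBit_lt_two_pow (by omega)]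

theorem exists_bits {n : ℕ} (x : Point n) : ∃ t < 2 ^ n, bits n t = x :=
  ⟨Nat.ofBits x, Nat.ofBits_lt_two_pow x, funext fun i => by simp [bits]⟩

theorem testBit_succ_eq (t i : ℕ) :
    (t + 1).testBit i = (t.testBit i ^^ decide (∀ j < i, t.testBit j = true)) := by
  induction i generalizing t with
  | zero =>
    rcases Nat.mod_two_eq_zero_or_one t with h | h <;> simp [Nat.testBit_zero, Nat.add_mod, h]
  | succ i ih =>
    rw [Nat.testBit_succ, Nat.testBit_succ]
    rcases Nat.even_or_odd' t with ⟨r, rfl | rfl⟩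
    · have h1 : (2 * r + 1) / 2 = r := by omega
      have h2 : (2 * r) / 2 = r := by omega
      have h3 : ¬ ∀ j < i + 1, (2 * r).testBit j = true := fun h => by
        have := h 0 (by omega)
        simp at this
      rw [h1, h2, decide_eq_false h3, Bool.xor_false]
    · have h1 : (2 * r + 1 + 1) / 2 = r + 1 := by omega
      have h2 : (2 * r + 1) / 2 = r := by omega
      have h3 : (∀ j < i + 1, (2 * r + 1).testBit j = true) ↔ ∀ j < i, r.testBit j = true := by
        constructor
        · intro h j hj
          have := h (j + 1) (by omega)
          rwa [Nat.testBit_succ, h2] at this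
        · rintro h (_ | j) hj
          · simp
          · rw [Nat.testBit_succ, h2]
            exact h j (by omega)
      rw [h1, h2, ih, decide_eq_decide.2 h3]

/-- All low bits are one exactly when incrementing carries into position `n`, so this is
`testBit_succ_eq` read at that position. -/
theorem forall_testBit_iff {n t : ℕ} (ht : t < 2 ^ n) :
    (∀ j < n, t.testBit j = true) ↔ t = 2 ^ n - 1 := by
  have h := testBit_succ_eq t n
  rw [Nat.testBit_lt_two_pow ht, Bool.false_xor] at h
  rw [← decide_eq_true_iff (p := ∀ j < n, t.testBit j = true), ← h]
  rcases Nat.lt_or_ge (t + 1) (2 ^ n) with h' | h'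
  · rw [Nat.testBit_lt_two_pow h']
    simp; omega
  · obtain h2 : t + 1 = 2 ^ n := by omega
    rw [h2, Nat.testBit_two_pow_self]
    simp; omega

theorem toBit_add (y z : ZMod 2) : toBit (y + z) = (toBit y ^^ toBit z) := by revert y z; decide

theorem prod_ofBit {ι : Type*} (I : Finset ι) (v : ι → Bool) :
    ∏ i ∈ I, ofBit (v i) = ofBit (decide (∀ i ∈ I, v i = true)) := by
  classical
  induction I using Finset.induction_on with
  | empty => simp [ofBit]
  | insert i I hi ih =>
    rw [Finset.prod_insert hi, ih]
    cases h : v i <;> simp [h, ofBit]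

/-- The carry into position `i` when a number is incremented. -/
def carry {n : ℕ} (p : Point n) (i : ℕ) : ZMod 2 :=
  ∏ j ∈ Finset.univ.filter (fun j : Fin n => j.1 < i), ofBit (p j)

theorem carry_bits (n t i : ℕ) (hi : i ≤ n) :
    carry (bits n t) i = ofBit (decide (∀ j < i, t.testBit j = true)) := by
  rw [carry, prod_ofBit]
  congr 1
  rw [decide_eq_decide]
  simp only [Finset.mem_filter, Finset.mem_univ, true_and, bits]
  exact ⟨fun h j hj => h ⟨j, by omega⟩ hj, fun h j hj => h j hj⟩

theorem carry_bits_self {n t : ℕ} (ht : t < 2 ^ n) :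
    carry (bits n t) n = ofBit (decide (t = 2 ^ n - 1)) := by
  rw [carry_bits n t n le_rfl, decide_eq_decide.2 (forall_testBit_iff ht)]

/-- The successor of a number, where the largest number is its own successor. -/
theorem bits_min_succ (n t : ℕ) (i : Fin n) :
    toBit (ofBit (bits n (min t (2 ^ n - 1)) i) + (carry (bits n (min t (2 ^ n - 1))) i +
      carry (bits n (min t (2 ^ n - 1))) n)) = bits n (min (t + 1) (2 ^ n - 1)) i := by
  have hpos : 0 < 2 ^ n := by positivity
  rcases Nat.lt_or_ge t (2 ^ n - 1) with h | h
  · rw [min_eq_left h.le, min_eq_left (by omega), carry_bits_self (by omega),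
      decide_eq_false (by omega), carry_bits n t i i.2.le]
    simp only [toBit_add, toBit_ofBit, Bool.xor_false, bits, testBit_succ_eq t i]
  -- At the largest number the carry into position `i` and the overflow carry are both one and
  -- cancel, so the counter stops.
  · rw [min_eq_right h, min_eq_right (by omega), carry_bits_self (by omega), carry_bits n _ i i.2.le]
    have h2 : ∀ j < i.1, (2 ^ n - 1).testBit j = true := fun j hj =>
      (forall_testBit_iff (by omega)).2 rfl j (by omega)
    rw [decide_eq_true h2]
    simp [toBit_add]

/-! ### An adversary that forces many mistakes -/

/-- The concepts that are dominated by `h`. -/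
def dominated {n : ℕ} (h : Point n → Bool) : ConceptClass n :=
  {f | ∀ x, f x = true → h x = true}

section Game
variable {n : ℕ} {A : Adversary n} {h : Point n → Bool}

/-- Each point before the last is presented once, and the last one, repeated for ever, always gets
label `0`. Hence the indicator of the points labelled `1` is itself a consistent concept. -/
theorem isFor_dominated
    (hp : ∀ (L : Learner n) (t : ℕ), pointAt L A t = bits n (min t (2 ^ n - 1)))
    (hl : ∀ (L : Learner n) (t : ℕ), labelAt L A t =
      (h (pointAt L A t) && !answerAt L A t && decide (t < 2 ^ n - 1))) :
    A.IsFor (dominated h) := by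
  classical
  intro L t
  have hpos : 0 < 2 ^ n := by positivity
  refine ⟨fun x => decide (∃ u, pointAt L A u = x ∧ labelAt L A u = true), ?_, ?_⟩
  · intro x hx
    obtain ⟨u, rfl, hu⟩ := of_decide_eq_true hx
    rw [hl] at hu
    simp only [Bool.and_eq_true] at hu
    exact hu.1.1
  · intro u _
    cases hu : labelAt L A u with
    | true => exact decide_eq_true ⟨u, rfl, hu⟩
    | false =>
      refine decide_eq_false ?_
      rintro ⟨v, hv, hv'⟩
      have hlt : v < 2 ^ n - 1 := by
        rw [hl] at hv'
        simp only [Bool.and_eq_true, decide_eq_true_eq] at hv'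
        exact hv'.2
      rw [hp, hp] at hv
      have := bits_injOn (by omega) (by omega) hv
      obtain rfl : v = u := by omega
      rw [hu] at hv'
      exact absurd hv' (by decide)

/-- Where `h` is `1`, the label is the negation of the answer, except at the last point; that point
accounts for the `+ 1`. -/
theorem card_le_mistakes
    (hp : ∀ (L : Learner n) (t : ℕ), pointAt L A t = bits n (min t (2 ^ n - 1)))
    (hl : ∀ (L : Learner n) (t : ℕ), labelAt L A t =
      (h (pointAt L A t) && !answerAt L A t && decide (t < 2 ^ n - 1)))
    (L : Learner n) :
    ({x | h x = true}.ncard : ℕ∞) ≤ mistakes L A + 1 := by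
  have hpos : 0 < 2 ^ n := by positivity
  rw [Set.Finite.cast_ncard_eq (Set.toFinite _)]
  calc {x | h x = true}.encard
      ≤ (bits n '' (insert (2 ^ n - 1) {t | answerAt L A t ≠ labelAt L A t})).encard := by
        refine Set.encard_le_encard fun x hx => ?_
        obtain ⟨t, ht, rfl⟩ := exists_bits x
        refine ⟨t, ?_, rfl⟩
        by_cases h' : t = 2 ^ n - 1
        · exact Or.inl h'
        · right
          have hpt : pointAt L A t = bits n t := by rw [hp, min_eq_left (by omega)]
          have h2 : t < 2 ^ n - 1 := by omega
          have hx' : h (bits n t) = true := hx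
          show answerAt L A t ≠ labelAt L A t
          rw [hl, hpt, hx']
          cases answerAt L A t <;> simp [h2]
    _ ≤ (insert (2 ^ n - 1) {t | answerAt L A t ≠ labelAt L A t}).encard := Set.encard_image_le _ _
    _ ≤ mistakes L A + 1 := Set.encard_insert_le _ _

end Game

/-- Functions that are computed by a small circuit are those of a small adversary. -/
theorem Realizable.exists_adversary {n r g : ℕ} {next : Fin r → (Fin (r + 1) → Bool) → ZMod 2}
    {lab : (Fin (r + 1) → Bool) → ZMod 2} {pt : Fin n → (Fin (r + 1) → Bool) → ZMod 2}
    (H : Realizable g (Set.range next ∪ {lab} ∪ Set.range pt)) :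
    ∃ g' ≤ g, ∃ (c : Circuit (r + 1) g') (u : Fin r → Fin (r + 1 + g')) (l : Fin (r + 1 + g'))
      (p : Fin n → Fin (r + 1 + g')),
      (∀ x i, c.eval x (u i) = toBit (next i x)) ∧ (∀ x, c.eval x l = toBit (lab x)) ∧
      ∀ x i, c.eval x (p i) = toBit (pt i x) := by
  obtain ⟨g', hg', c, hc⟩ := H
  choose u hu using fun i => hc (next i) (by simp)
  obtain ⟨l, hl⟩ := hc lab (by simp)
  choose p hp using fun i => hc (pt i) (by simp)
  exact ⟨g', hg', c, u, l, p, fun x i => hu i x, hl, fun x i => hp i x⟩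

section Counter
variable (n : ℕ)

/-- The counter bits among the inputs of the counting adversary. -/
def counterBits (x : Fin (n + 1 + 1) → Bool) : Point n := fun i => x i.castSucc.castSucc

/-- The input functions. -/
def inputs : Set ((Fin (n + 1 + 1) → Bool) → ZMod 2) :=
  Set.range fun (i : Fin (n + 1 + 1)) (x : Fin (n + 1 + 1) → Bool) => ofBit (x i)

/-- The next counter value. The counter starts to run once its flag is set. -/
def counterNext (i : Fin n) (x : Fin (n + 1 + 1) → Bool) : ZMod 2 :=
  ofBit (counterBits n x i) +
    ofBit (x (Fin.last n).castSucc) * (carry (counterBits n x) i + carry (counterBits n x) n)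

/-- The label output by the counting adversary. -/
def counterLabel (h : Point n → Bool) (x : Fin (n + 1 + 1) → Bool) : ZMod 2 :=
  ofBit (h (counterBits n x)) * (1 + ofBit (x (Fin.last (n + 1)))) * (1 + carry (counterBits n x) n)

variable {n}

theorem costLE_carry {S : Set ((Fin (n + 1 + 1) → Bool) → ZMod 2)} (h1 : 1 ∈ S)
    (hS : inputs n ⊆ S) (i : ℕ) : CostLE S {fun x => carry (counterBits n x) i} n := by
  have h := CostLE.prod (S := S) (Finset.univ.filter fun j : Fin n => j.1 < i)
    (fun j x => ofBit (x j.castSucc.castSucc)) h1 fun j _ => hS ⟨j.castSucc.castSucc, rfl⟩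
  have e : (∏ j ∈ Finset.univ.filter (fun j : Fin n => j.1 < i),
      fun x : Fin (n + 1 + 1) → Bool => ofBit (x j.castSucc.castSucc)) =
      fun x => carry (counterBits n x) i := by
    funext x
    simp [carry, counterBits, Finset.prod_apply]
  rw [e] at h
  exact h.mono le_rfl le_rfl ((Finset.card_le_univ _).trans_eq (by simp))

/-- The circuit of the counting adversary. -/
theorem realizable_counter (h : Point n → Bool) {q : ℕ}
    (hh : CostLE (inputs n ∪ {0, 1}) {fun x => ofBit (h (counterBits n x))} q) :
    Realizable (q + (n * n + 10 * n + 7)) (Set.range (Fin.snoc (α := fun _ => _) (counterNext n) 1) ∪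
      {counterLabel n h} ∪ Set.range (counterNext n)) := by
  have c1 : CostLE (inputs n) {0, 1} 3 :=
    costLE_const (f := fun x => ofBit (x (Fin.last (n + 1)))) ⟨_, rfl⟩
  have c2 := c1.trans hh
  have c3 := c2.trans (costLE_carry (by simp) Set.subset_union_left n)
  have c4 := c3.trans (CostLE.range (fun (i : Fin n) x => carry (counterBits n x) i) fun i =>
    costLE_carry (by simp) Set.subset_union_left i)
  have c5 := c4.trans (CostLE.range (q := 9) (counterNext n) fun i => by
    have e : counterNext n i = (fun x => ofBit (x i.castSucc.castSucc)) +
        (fun x => ofBit (x (Fin.last n).castSucc)) * ((fun x => carry (counterBits n x) i) +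
          fun x => carry (counterBits n x) n) := rfl
    rw [e]
    refine ((costLE_add ?_ ?_).trans' (costLE_mul ?_ (Or.inr rfl))).trans'
      (costLE_add ?_ (Or.inr rfl))
    · exact Or.inr (Or.inr ⟨i, rfl⟩)
    · exact Or.inr (Or.inl (Or.inr rfl))
    · exact Or.inl (Or.inl ⟨_, rfl⟩)
    · exact Or.inl (Or.inl ⟨_, rfl⟩))
  have c6 := c5.trans (U := {counterLabel n h}) (r := 4) (by
    have e : counterLabel n h = (fun x => ofBit (h (counterBits n x))) *
        (1 + fun x => ofBit (x (Fin.last (n + 1)))) * (1 + fun x => carry (counterBits n x) n) := rfl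
    rw [e]
    refine (((costLE_one_add (f := fun x => ofBit (x (Fin.last (n + 1)))) ?_).union
      (costLE_one_add (f := fun x => carry (counterBits n x) n) ?_)).trans (costLE_mul ?_ ?_)).trans'
      (costLE_mul (Or.inr (Or.inr rfl)) ?_)
    · exact Or.inl ⟨_, rfl⟩
    · exact Or.inr (Or.inl (Or.inl (Or.inr rfl)))
    · exact Or.inl (Or.inr (Or.inl (Or.inl (Or.inl (Or.inr rfl)))))
    · exact Or.inr (Or.inl rfl)
    · exact Or.inr (Or.inl (Or.inr rfl)))
  -- Beyond `q`, the gates are `3` for the constants, `n` for the overflow carry, `n * n` for the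
  -- other carries, `9 * n` for the counter bits and `4` for the label.
  refine (c6 (inputs n) le_rfl 0 realizable_inputs).mono ?_ ?_
  · simp only [Fintype.card_fin]
    ring_nf; omega
  · rintro f ((⟨i, rfl⟩ | rfl) | hf)
    · refine Fin.lastCases ?_ (fun j => ?_) i
      · rw [Fin.snoc_last (α := fun _ => _)]
        simp
      · rw [Fin.snoc_castSucc (α := fun _ => _)]
        exact Or.inr (Or.inl (Or.inr ⟨j, rfl⟩))
    · exact Or.inr (Or.inr rfl)
    · exact Or.inr (Or.inl (Or.inr hf))

/-- An adversary for the concepts dominated by `h` that forces almost as many mistakes as `h` has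
ones, and whose size is essentially the circuit size of `h`. -/
theorem exists_adversary_dominated (h : Point n → Bool) {q : ℕ}
    (hh : CostLE (inputs n ∪ {0, 1}) {fun x => ofBit (h (counterBits n x))} q) :
    ∃ A : Adversary n, A.size ≤ q + (n * n + 10 * n + 7) ∧ A.IsFor (dominated h) ∧
      ∀ L : Learner n, ({x | h x = true}.ncard : ℕ∞) ≤ mistakes L A + 1 := by
  obtain ⟨g, hg, c, u, l, p, hu, hl, hp⟩ := (realizable_counter h hh).exists_adversary
  set A : Adversary n := ⟨n + 1, g, c, u, l, p⟩ with hA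
  have hpos : 0 < 2 ^ n := by positivity
  have hpt (L : Learner n) (t : ℕ) (i : Fin n) : pointAt L A t i =
      toBit (counterNext n i (Fin.snoc (α := fun _ => Bool) (config L A t).adversaryState
        (config L A t).answer)) := hp _ i
  -- The state holds the previous point, because its label is output only after the answer is seen.
  -- The flag is unset only in the first round, so the zero point is presented before counting
  -- begins.
  have hst (L : Learner n) (t : ℕ) : (config L A (t + 1)).adversaryState =
      Fin.snoc (α := fun _ => Bool) (pointAt L A t) true := by
    funext i
    change c.eval _ (u i) = _
    rw [hu]
    revert i
    refine Fin.lastCases ?_ fun i => ?_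
    · rw [Fin.snoc_last (α := fun _ => _), Fin.snoc_last (α := fun _ => _)]
      rfl
    · rw [Fin.snoc_castSucc (α := fun _ => _), Fin.snoc_castSucc (α := fun _ => _), hpt]
  have hcb (α : Fin n → Bool) (v y : Bool) : counterBits n (Fin.snoc (α := fun _ => Bool)
      (Fin.snoc (α := fun _ => Bool) α v : Fin (n + 1) → Bool) y) = α := by
    funext i
    simp only [counterBits]
    rw [Fin.snoc_castSucc (α := fun _ => _), Fin.snoc_castSucc (α := fun _ => _)]
  have hpoint (L : Learner n) (t : ℕ) : pointAt L A t = bits n (min t (2 ^ n - 1)) := by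
    induction t with
    | zero =>
      funext i
      rw [hpt]
      simp [config, counterNext, counterBits, bits, Fin.snoc_castSucc (α := fun _ => Bool), ofBit,
        toBit]
    | succ t ih =>
      funext i
      rw [hpt, hst, counterNext, hcb, Fin.snoc_castSucc (α := fun _ => _),
        Fin.snoc_last (α := fun _ => _), ih, ← bits_min_succ]
      simp [ofBit]
  have hlabel (L : Learner n) (t : ℕ) : labelAt L A t =
      (h (pointAt L A t) && !answerAt L A t && decide (t < 2 ^ n - 1)) := by
    change c.eval (Fin.snoc (α := fun _ => Bool) (config L A (t + 1)).adversaryState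
      (answerAt L A t)) l = _
    rw [hl, hst, counterLabel, hcb, Fin.snoc_last (α := fun _ => _)]
    simp only [toBit_mul, toBit_one_add, toBit_ofBit]
    congr 1
    rw [hpoint, carry_bits_self (by omega), toBit_ofBit, ← decide_not, decide_eq_decide]
    omega
  refine ⟨A, ?_, isFor_dominated hpoint hlabel, card_le_mistakes hpoint hlabel⟩
  exact max_le hg (by change n + 1 ≤ _; nlinarith)

end Counter

/-! ### The concept class -/

section Class
variable {n : ℕ} {F : Type*} [Field F] [Algebra (ZMod 2) F] (b : Module.Basis (Fin n) (ZMod 2) F)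

/-- The field element with given coordinates. -/
noncomputable def fieldPoint (p : Point n) : F := ∑ i, ofBit (p i) • b i

theorem repr_fieldPoint (p : Point n) (i : Fin n) : b.repr (fieldPoint b p) i = ofBit (p i) := by
  rw [fieldPoint, b.repr_sum_self]

theorem fieldPoint_injective : Function.Injective (fieldPoint b) := by
  intro p p' h
  funext i
  have := repr_fieldPoint b p i
  rw [h, repr_fieldPoint] at this
  simpa using (congrArg toBit this).symm

/-- A coordinate of a polynomial, plus a constant. -/
noncomputable def polyHash {k : ℕ} (l : Fin n) (a : Fin k → F) (e : ZMod 2) (p : Point n) : Bool :=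
  toBit (b.repr (∑ i, a i * fieldPoint b p ^ (i : ℕ)) l + e)

theorem costLE_polyHash {k : ℕ} (l : Fin n) (a : Fin k → F) (e : ZMod 2) :
    CostLE (inputs n ∪ {0, 1}) {fun x => ofBit (polyHash b l a e (counterBits n x))}
      (k * (n * (n * (n * 6 + 4) + 4)) + 4) := by
  have hU : coords b (fun x => fieldPoint b (counterBits n x)) ⊆ inputs n ∪ {0, 1} := by
    rintro _ ⟨i, rfl⟩
    refine Or.inl ⟨i.castSucc.castSucc, ?_⟩
    funext x
    exact (repr_fieldPoint b (counterBits n x) i).symm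
  have h := (costLE_polynomial b (by simp) (by simp) hU a).trans'
    (costLE_add (f := fun x => b.repr (∑ i, a i * fieldPoint b (counterBits n x) ^ (i : ℕ)) l)
      (h := fun _ => e) (Or.inr ⟨l, rfl⟩) (Or.inl (const_mem (by simp) (by simp) e)))
  convert h using 2
  funext x
  simp [polyHash]

/-- A function with small circuits and many ones that is constantly `1` on none of the sets of
positive points that small adversaries produce against a fixed learner. -/
theorem exists_polyHash [Fintype F] (hn : 1 ≤ n) {s k : ℕ} (hk : 3 ≤ k)
    (hJ : 2 * Nat.card (AdversaryCode n s) < 2 ^ k) (L : Learner n) (l : Fin n) :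
    ∃ (a : Fin k → F) (e : ZMod 2),
      (∀ A : Adversary n, A.size ≤ s → k ≤ (positives L A).ncard →
        ∃ x ∈ positives L A, polyHash b l a e x = false) ∧
      2 ^ n + 4 ≤ 4 * {x | polyHash b l a e x = true}.ncard := by
  classical
  have hcard : Nat.card (Point n) = 2 ^ n := by simp
  -- For `n = 1` half of the cube is too few ones for the stated bound, but `k ≥ 3` exceeds the
  -- number of points, so the constant `1` will do.
  rcases hn.eq_or_lt with rfl | hn
  · refine ⟨0, 1, fun A _ hA => ?_, ?_⟩
    · have := hA.trans (Set.ncard_le_card _)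
      omega
    · have : {x : Point 1 | polyHash b l (0 : Fin k → F) 1 x = true} = Set.univ := by
        ext x
        simp [polyHash, toBit]
      rw [this, Set.ncard_univ, hcard]
      norm_num
  · have hφ : Function.Surjective (b.coord l) := fun z => ⟨z • b l, by simp⟩
    obtain ⟨a, ha⟩ := exists_polynomial_not_constant (b.coord l) hφ hJ
      fun c => (positives L c.decode).toFinset.image (fieldPoint b)
    have hgood (e : ZMod 2) (A : Adversary n) (hA : A.size ≤ s) (hkA : k ≤ (positives L A).ncard) :
        ∃ x ∈ positives L A, polyHash b l a e x = false := by
      obtain ⟨c, rfl⟩ := AdversaryCode.exists_decode A hA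
      -- Avoiding the value `1 + e` makes the shifted bit `0`. Non-constancy provides this for both
      -- shifts, so `e` may be chosen afterwards to have at least half ones.
      obtain ⟨y, hy, hne⟩ := ha c (by
        rw [Finset.card_image_of_injective _ (fieldPoint_injective b)]
        rwa [Set.ncard_eq_toFinset_card'] at hkA) (1 + e)
      obtain ⟨x, hx, rfl⟩ := Finset.mem_image.1 hy
      refine ⟨x, by simpa using hx, ?_⟩
      rw [Module.Basis.coord_apply] at hne
      rw [polyHash]
      generalize b.repr (∑ i, a i * fieldPoint b x ^ (i : ℕ)) l = z at hne ⊢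
      revert hne
      revert z e
      decide
    have hsum : {x | polyHash b l a 0 x = true}.ncard + {x | polyHash b l a 1 x = true}.ncard =
        2 ^ n := by
      have : {x | polyHash b l a 1 x = true} = {x | polyHash b l a 0 x = true}ᶜ := by
        ext x
        simp only [polyHash, Set.mem_ofPred_eq, Set.mem_compl_iff]
        generalize b.repr (∑ i, a i * fieldPoint b x ^ (i : ℕ)) l = z
        revert z
        decide
      rw [this, Set.ncard_add_ncard_compl, hcard]
    have h4 : 2 ^ 2 ≤ 2 ^ n := Nat.pow_le_pow_right two_pos hn
    rcases Nat.lt_or_ge {x | polyHash b l a 0 x = true}.ncard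
      {x | polyHash b l a 1 x = true}.ncard with h | h
    · exact ⟨a, 1, hgood 1, by omega⟩
    · exact ⟨a, 0, hgood 0, by omega⟩

end Class

theorem clog_le_two_mul_logb {s : ℕ} (hs : 2 ≤ s) :
    1 ≤ Real.logb 2 s ∧ (Nat.clog 2 s : ℝ) ≤ 2 * Real.logb 2 s := by
  have h1 : 1 ≤ Real.logb 2 s := by
    rw [Real.le_logb_iff_rpow_le one_lt_two (by positivity)]
    simpa using (by exact_mod_cast hs : (2 : ℝ) ≤ s)
  refine ⟨h1, ?_⟩
  have h2 := Nat.pow_pred_clog_lt_self one_lt_two (show 1 < s by omega)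
  have h3 : ((Nat.clog 2 s).pred : ℝ) ≤ Real.logb 2 s := by
    rw [Real.le_logb_iff_rpow_le one_lt_two (by positivity), Real.rpow_natCast]
    exact_mod_cast h2.le
  have h4 : (Nat.clog 2 s : ℝ) ≤ (Nat.clog 2 s).pred + 1 := by
    exact_mod_cast Nat.le_succ_of_pred_le le_rfl
  linarith

/-- A class with a strong adversary of size about `k`, on which the learning algorithm with memory
about `n * k` makes at most `k` mistakes against all adversaries of size `s`. -/
theorem exists_conceptClass {n s L : ℕ} (hn : 1 ≤ n) (hs : 2 ≤ s) (hns : n ≤ s) (hL : s ≤ 2 ^ L) :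
    ∃ C : ConceptClass n,
      (∃ A : Adversary n, A.IsFor C ∧
        A.size ≤ (18 * s * L + 2) * (n * (n * (n * 6 + 4) + 4)) + 4 + (n * n + 10 * n + 7) ∧
        ∀ L : Learner n, (2 : ℝ≥0∞) ^ n / 4 ≤ (mistakes L A : ℝ≥0∞)) ∧
      ∀ A : Adversary n, A.IsFor C → A.size ≤ s →
        mistakes (memo.toLearner n ((18 * s * L + 3) * (n + 1))) A ≤ (18 * s * L + 2 : ℕ) := by
  have hL1 : 1 ≤ L := by
    rcases Nat.eq_zero_or_pos L with rfl | h
    · simp at hL; omega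
    · exact h
  -- The `+ 2` makes `2 ^ k` four times the bound on the number of adversaries. The memory below
  -- holds `k` stored points and the pending one, and does not depend on the class.
  set k := 18 * s * L + 2 with hk
  set m := (18 * s * L + 3) * (n + 1) with hm
  have hk3 : 3 ≤ k := by nlinarith
  have hJ : 2 * Nat.card (AdversaryCode n s) < 2 ^ k := by
    have h1 := card_adversaryCode_le hns hs hL
    have h2 : 2 ^ k = 4 * 2 ^ (18 * s * L) := by rw [hk, pow_add]; ring
    have h3 : 0 < 2 ^ (18 * s * L) := by positivity
    omega
  have := Fintype.ofFinite (GaloisField 2 n)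
  let b : Module.Basis (Fin n) (ZMod 2) (GaloisField 2 n) :=
    Module.finBasisOfFinrankEq _ _ (GaloisField.finrank 2 (by omega))
  obtain ⟨a, e, h1, h2⟩ := exists_polyHash b hn hk3 hJ (memo.toLearner n m) ⟨0, hn⟩
  refine ⟨dominated (polyHash b ⟨0, hn⟩ a e), ?_, ?_⟩
  · obtain ⟨A, hA, hfor, hmis⟩ := exists_adversary_dominated _ (costLE_polyHash b ⟨0, hn⟩ a e)
    refine ⟨A, hfor, hA, fun L' => ?_⟩
    have h3 := hmis L'
    refine ENNReal.div_le_of_le_mul ?_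
    generalize mistakes L' A = M at h3
    cases M with
    | top => simp
    | coe M =>
      have h4 : {x | polyHash b ⟨0, hn⟩ a e x = true}.ncard ≤ M + 1 := by exact_mod_cast h3
      have h5 : 2 ^ n ≤ M * 4 := by omega
      rw [ENat.toENNReal_coe]
      exact_mod_cast h5
  · intro A hA hs'
    -- Otherwise some positive point has `h = 0`, and no dominated concept is consistent with its
    -- label.
    have hlt : (positives (memo.toLearner n m) A).ncard < k := by
      by_contra hge
      obtain ⟨x, ⟨t, rfl, ht⟩, hx⟩ := h1 A hs' (not_lt.1 hge)
      obtain ⟨f, hf, hft⟩ := hA (memo.toLearner n m) (t + 1)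
      have := hf _ ((hft t (by omega)).trans ht)
      rw [hx] at this
      exact absurd this (by decide)
    refine (mistakes_memo_le hA ?_).trans (by exact_mod_cast hlt.le)
    exact Nat.mul_le_mul_right _ (Nat.succ_le_succ hlt.le)

end OnlineLearning

theorem mainTheorem11 :
    ∃ (p : Polynomial ℕ) (c : ℝ) (M : OnlineLearning.LearningAlgorithm),
      ∀ n s : ℕ, 1 ≤ n → 2 ≤ s → n ≤ s →
        ∃ C : OnlineLearning.ConceptClass n,
          (∃ A : OnlineLearning.Adversary n,
            A.IsFor C ∧
            (A.size : ℝ) ≤ s * Real.logb 2 s * (p.eval n : ℕ) ∧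
            ∀ L : OnlineLearning.Learner n,
              (2 : ℝ≥0∞) ^ n / 4 ≤ (OnlineLearning.mistakes L A : ℝ≥0∞)) ∧
          (∀ A : OnlineLearning.Adversary n, A.IsFor C → A.size ≤ s →
            ∃ m : ℕ,
              (m : ℝ) ≤ c * (n * s * Real.logb 2 s) ∧
              (OnlineLearning.mistakes (M.toLearner n m) A : ℝ≥0∞) ≤
                ENNReal.ofReal (c * (s * Real.logb 2 s))) := by
  -- The bounds in terms of `L = ⌈log₂ s⌉` are `300 * n ^ 3 * (s * L)` for the size, `40 * n * (s *
  -- L)` for the memory and `20 * (s * L)` for the mistakes. Replacing `L` by at most `2 * log₂ s`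
  -- doubles them.
  refine ⟨600 * Polynomial.X ^ 3, 80, OnlineLearning.memo, fun n s hn hs hns => ?_⟩
  obtain ⟨hlog, hclog⟩ := OnlineLearning.clog_le_two_mul_logb hs
  obtain ⟨C, ⟨A, hA, hsize, hmis⟩, hC⟩ := OnlineLearning.exists_conceptClass hn hs hns
    (Nat.le_pow_clog one_lt_two s)
  set L := Nat.clog 2 s with hL
  set ℓ := Real.logb 2 s with hℓ
  have hL1 : 1 ≤ L := Nat.clog_pos one_lt_two hs
  have hsL : 2 ≤ s * L := by nlinarith
  have hsL' : ((s * L : ℕ) : ℝ) ≤ 2 * (s * ℓ) := by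
    push_cast
    nlinarith [(by positivity : (0 : ℝ) ≤ s)]
  refine ⟨C, ⟨A, hA, ?_, hmis⟩, fun B hB hBs =>
    ⟨(18 * s * L + 3) * (n + 1), ?_, ?_⟩⟩
  · have h3 : A.size ≤ s * L * (300 * n ^ 3) := by
      refine hsize.trans ?_
      have e1 : n ≤ n ^ 3 := Nat.le_self_pow (by omega) n
      have e2 : n ^ 2 ≤ n ^ 3 := Nat.pow_le_pow_right hn (by omega)
      have e3 : 1 ≤ n ^ 3 := Nat.one_le_pow _ _ hn
      have e4 : n * (n * (n * 6 + 4) + 4) ≤ 14 * n ^ 3 := by nlinarith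
      have e5 : 4 + (n * n + 10 * n + 7) ≤ 22 * n ^ 3 := by nlinarith
      have e6 : (18 * s * L + 2) * (n * (n * (n * 6 + 4) + 4)) ≤ (19 * (s * L)) * (14 * n ^ 3) :=
        Nat.mul_le_mul (by nlinarith) e4
      nlinarith
    have h4 : (A.size : ℝ) ≤ ((s * L : ℕ) : ℝ) * (300 * n ^ 3) := by exact_mod_cast h3
    refine h4.trans ?_
    simp only [Polynomial.eval_mul, Polynomial.eval_ofNat, Polynomial.eval_pow, Polynomial.eval_X]
    push_cast at hsL' ⊢
    nlinarith [(by positivity : (0 : ℝ) ≤ (n : ℝ) ^ 3)]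
  · have h3 : (18 * s * L + 3) * (n + 1) ≤ 40 * (n * (s * L)) := by
      calc _ ≤ (20 * (s * L)) * (2 * n) := Nat.mul_le_mul (by nlinarith) (by omega)
        _ = _ := by ring
    have h4 : (((18 * s * L + 3) * (n + 1) : ℕ) : ℝ) ≤ 40 * (n * ((s * L : ℕ) : ℝ)) := by
      exact_mod_cast h3
    refine h4.trans ?_
    have : (n : ℝ) * ((s * L : ℕ) : ℝ) ≤ n * (2 * (s * ℓ)) :=
      mul_le_mul_of_nonneg_left hsL' (by positivity)
    linarith
  · have h3 : 18 * s * L + 2 ≤ 20 * (s * L) := by nlinarith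
    have h4 : ((18 * s * L + 2 : ℕ) : ℝ) ≤ 80 * (s * ℓ) := by
      have : ((18 * s * L + 2 : ℕ) : ℝ) ≤ 20 * ((s * L : ℕ) : ℝ) := by exact_mod_cast h3
      have : 0 ≤ (s : ℝ) * ℓ := by positivity
      linarith
    calc (OnlineLearning.mistakes _ B : ℝ≥0∞)
        ≤ (((18 * s * L + 2 : ℕ) : ℕ∞) : ℝ≥0∞) := ENat.toENNReal_le.2 (hC B hB hBs)
      _ = ENNReal.ofReal ((18 * s * L + 2 : ℕ) : ℝ) := by
          rw [ENat.toENNReal_coe, ENNReal.ofReal_natCast]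
      _ ≤ _ := ENNReal.ofReal_le_ofReal h4
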